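/- Let $b>0$. For a bounded planar domain $\Omega$ write $\tilde H(s)=\frac1{|\Omega|}\int_\Omega \tilde H(s;\mathbf r)\,d\mathbf r$ for the (Laplace-transformed, normalized) heat content, where $\tilde H(s;\cdot)$ is the weak solution in $H^1_0(\Omega)$ of $\Delta \tilde H-s^2\tilde H=-1$ in $\Omega$, $\tilde H=0$ on $\partial\Omega$. Let $\Omega_\varepsilon$ be the ellipse with semi-minor axis $b$, eccentricity $\varepsilon\in[0,1)$ and hence semi-major axis $a=b/\sqrt{1-\varepsilon^2}$, and let $D_b=\{x^2+y^2<b^2\}$. Let $s$ be a complex number outside the two cuts $\pm i[\pi/(2b),\infty)$. (i) For every $\varepsilon\in[0,1)$, the heat content $\tilde H_\varepsilon(s)$ of $\Omega_\varepsilon$ is well defined and equals the average over $D_b$ of the solution in $H^1_0(D_b)$ of the anisotropic Dirichlet problem $$\partial_y^2u+(1-\varepsilon^2)\,\partial_x^2u-s^2u=-1\ \text{ in } D_b,\qquad u=0\ \text{ on }\partial D_b .$$ (ii) The leading-order problem $\partial_y^2 u_0-s^2u_0=-1$ in $D_b$, $u_0=0$ on $\partial D_b$, has a solution that is continuous on $\overline{D_b}$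 and of class $C^2$ in $y$ in $D_b$, and all such solutions have the same average over $D_b$, denoted $\tilde H_0^{(1)}(s)$. As $\varepsilon\to1^-$ with $b$ fixed (so that $a\to\infty$), $$\tilde H_\varepsilon(s)\to \tilde H_0^{(1)}(s).$$ (iii) If $s\ne0$, then $$\tilde H_0^{(1)}(s)=\frac1{s^2}-\frac1{\pi b s^3}\int_0^{2\pi}\cos\varphi\,\tanh(bs\cos\varphi)\,d\varphi .$$ (iv) If $|s|<\pi/(2b)$, then $$\tilde H_0^{(1)}(s)=-2b^2\sum_{k=2}^\infty\frac{(2^{2k}-1)B_{2k}}{(k!)^2}\,(bs)^{2k-4},$$ where $B_{2k}$ are the Bernoulli numbers and the series converges absolutely. For complex $s$ with $|s|>\pi/(2b)$ the series diverges. -/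

import Mathlib

open MeasureTheory Filter Topology Set

/-- The open elliptic domain `x² / a² + y² / b² < 1` with semi-axes `a` and `b`. -/
def ellipseDomain (a b : ℝ) : Set (ℝ × ℝ) := {p | p.1 ^ 2 / a ^ 2 + p.2 ^ 2 / b ^ 2 < 1}

/-- The open disk of radius `b` centred at the origin. -/
def diskDomain (b : ℝ) : Set (ℝ × ℝ) := {p | p.1 ^ 2 + p.2 ^ 2 < b ^ 2}

/-- The partial derivative `∂φ/∂x`. -/
noncomputable def partialX (φ : ℝ × ℝ → ℂ) (p : ℝ × ℝ) : ℂ := fderiv ℝ φ p (1, 0)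

/-- The partial derivative `∂φ/∂y`. -/
noncomputable def partialY (φ : ℝ × ℝ → ℂ) (p : ℝ × ℝ) : ℂ := fderiv ℝ φ p (0, 1)

/-- Test functions on `Ω`: smooth, complex valued, with compact support contained in `Ω`. -/
structure IsTestFunction (Ω : Set (ℝ × ℝ)) (φ : ℝ × ℝ → ℂ) : Prop where
  smooth : ContDiff ℝ (⊤ : ℕ∞) φ
  compact : HasCompactSupport φ
  support : tsupport φ ⊆ Ω

/-- `u` belongs to the Sobolev space `H¹₀(Ω)` (the closure of the test functions in the `H¹` norm)
and its weak gradient is `(ux, uy)`. -/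
structure MemSobolevZero (Ω : Set (ℝ × ℝ)) (u ux uy : ℝ × ℝ → ℂ) : Prop where
  memLp : MemLp u 2 (volume.restrict Ω)
  memLp_x : MemLp ux 2 (volume.restrict Ω)
  memLp_y : MemLp uy 2 (volume.restrict Ω)
  approx : ∃ φ : ℕ → ℝ × ℝ → ℂ, (∀ n, IsTestFunction Ω (φ n)) ∧
    Tendsto (fun n => eLpNorm (u - φ n) 2 (volume.restrict Ω)) atTop (𝓝 0) ∧
    Tendsto (fun n => eLpNorm (ux - partialX (φ n)) 2 (volume.restrict Ω)) atTop (𝓝 0) ∧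
    Tendsto (fun n => eLpNorm (uy - partialY (φ n)) 2 (volume.restrict Ω)) atTop (𝓝 0)

/-- `u` is the weak solution of the Dirichlet problem
`κx ∂²u/∂x² + κy ∂²u/∂y² - s² u = -1` in `Ω`, `u = 0` on the boundary of `Ω`. -/
def IsDirichletSolution (Ω : Set (ℝ × ℝ)) (κx κy : ℝ) (s : ℂ) (u : ℝ × ℝ → ℂ) : Prop :=
  ∃ ux uy : ℝ × ℝ → ℂ, MemSobolevZero Ω u ux uy ∧
    ∀ φ : ℝ × ℝ → ℂ, IsTestFunction Ω φ →
      ∫ p in Ω, ((κx : ℂ) * ux p * partialX φ p + (κy : ℂ) * uy p * partialY φ p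
        + s ^ 2 * u p * φ p) = ∫ p in Ω, φ p

/-- `h` is the Laplace-transformed normalized heat content at `s` for the diffusion
`κx ∂²/∂x² + κy ∂²/∂y²` in `Ω` with absorbing boundary: the average over `Ω` of the
local transformed heat content, which is the solution of the Dirichlet problem above. -/
def IsHeatContent (Ω : Set (ℝ × ℝ)) (κx κy : ℝ) (s : ℂ) (h : ℂ) : Prop :=
  ∃ u : ℝ × ℝ → ℂ, IsDirichletSolution Ω κx κy s u ∧ h = ⨍ p in Ω, u p

/-- `u` is the zeroth-order term, in powers of `1 - ε²`, of the local transformed heat content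
in the disk of radius `b`: it solves `∂²u/∂y² - s² u = -1` in the open disk, is continuous on the
closed disk and vanishes on the boundary circle. -/
structure IsLeadingTerm (b : ℝ) (s : ℂ) (u : ℝ × ℝ → ℂ) : Prop where
  continuousOn : ContinuousOn u {p | p.1 ^ 2 + p.2 ^ 2 ≤ b ^ 2}
  contDiffOn : ∀ x : ℝ, ContDiffOn ℝ 2 (fun y => u (x, y)) {y | x ^ 2 + y ^ 2 < b ^ 2}
  equation : ∀ x y : ℝ, x ^ 2 + y ^ 2 < b ^ 2 →
    deriv (deriv fun t => u (x, t)) y - s ^ 2 * u (x, y) = -1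
  boundary : ∀ x y : ℝ, x ^ 2 + y ^ 2 = b ^ 2 → u (x, y) = 0

/-- The two cuts `± i [π / (2b), ∞)` on the imaginary axis. -/
def imaginaryCuts (b : ℝ) : Set ℂ := {s | s.re = 0 ∧ Real.pi / (2 * b) ≤ |s.im|}

/-- The term of index `k ≥ 2` in the small-`s` expansion. -/
noncomputable def smallTerm (b : ℝ) (s : ℂ) (k : ℕ) : ℂ :=
  -2 * (b : ℂ) ^ 2 * (((2 : ℂ) ^ (2 * k) - 1) * ((bernoulli (2 * k) : ℚ) : ℂ)
    / (k.factorial : ℂ) ^ 2 * ((b : ℂ) * s) ^ (2 * k - 4))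

/-! ### Bernoulli numbers and the Taylor series of `tanh` -/

/-! A horizontal dilation carries the ellipse to the disk, turns the Laplacian into `∂_y² + κ ∂_x²`
with `κ = 1 - ε²`, and preserves averages (`IsHeatContent.comp_scaleX`). It remains to let `κ → 0`
in a fixed disk.

The key is coercivity, uniform in `κ`, of the form `s²⟨v, u⟩ + κ⟨∂ₓv, ∂ₓu⟩ + ⟨∂ᵧv, ∂ᵧu⟩` on `H¹₀`.
The disk lies in the strip `|y| < b`, so `μ²‖u‖² ≤ ‖∂ᵧu‖²` for every `μ < π/(2b)`
(`poincare_sobolev`). On the diagonal the form is therefore `(s² + μ²)‖u‖²` plus nonnegative terms.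
Off the cuts some `μ` keeps `s² + μ²` away from `(-∞, 0]`, and a rotation makes every part have
positive real part (`weakOp_coercive`). Lax–Milgram then gives the solution for `κ > 0`.

On each vertical chord the degenerate equation is an ODE, whose solution is explicit and unique off
the cuts because `cosh` and `sinh(sY)/s` do not vanish at the half-chord. This leading term
satisfies the weak equation with `κ = 0`. Comparing the solution for `κ` with a test function `t`
bounds the error by the distance from `(t, ∂ᵧt)` to the leading term and its `y`-derivative, plus
`κ‖∂ₓt‖²` (`norm_sub_sq_le_of_isWeakTriple`). With `t` fixed, `κ → 0` kills the last term, so `∂ₓt`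
needs no uniform control. Cutoffs of the leading term make the rest small, because it vanishes
linearly at the chord ends (`leadingApprox_bounds`).

The closed form comes from integrating over chords and substituting `x = b sin φ`. Expanding `z tanh
z` through the Bernoulli generating function and integrating termwise by Wallis' formula gives the
series in `s`; Euler's formula for `ζ(2k)` bounds the Bernoulli numbers on both sides and so fixes
the radius of convergence. -/

/-- Euler's formula for `ζ(2k)` reduces both bounds to `1 ≤ ζ(2k) ≤ ζ(2) = π²/6 ≤ 2`. The upper one
gives convergence of the generating series, the lower one divergence of the expansion in `s`. -/
theorem abs_bernoulli_two_mul_bounds {k : ℕ} (hk : k ≠ 0) :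
    2 / (2 * Real.pi) ^ (2 * k) ≤ |(bernoulli (2 * k) : ℝ)| / (2 * k).factorial ∧
      |(bernoulli (2 * k) : ℝ)| / (2 * k).factorial ≤ 4 / (2 * Real.pi) ^ (2 * k) := by
  have hz := hasSum_zeta_nat hk
  have hpos : 0 < (2 * Real.pi) ^ (2 * k) := by positivity
  have h1 : (1 : ℝ) ≤ (-1) ^ (k + 1) * 2 ^ (2 * k - 1) * Real.pi ^ (2 * k) *
      bernoulli (2 * k) / (2 * k).factorial := by
    have := le_hasSum hz 1 (fun j _ => by positivity)
    simpa using this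
  have h2 : (-1) ^ (k + 1) * 2 ^ (2 * k - 1) * Real.pi ^ (2 * k) *
      (bernoulli (2 * k) : ℝ) / (2 * k).factorial ≤ 2 := by
    have h3 : Real.pi ^ 2 / 6 ≤ 2 := by nlinarith [Real.pi_lt_d2, Real.pi_pos]
    refine le_trans (hasSum_le (fun n => ?_) hz hasSum_zeta_two) h3
    rcases Nat.eq_zero_or_pos n with rfl | hn
    · simp [hk]
    · have : (1 : ℝ) ≤ n := by exact_mod_cast hn
      gcongr
      omega
  have habs : (-1) ^ (k + 1) * 2 ^ (2 * k - 1) * Real.pi ^ (2 * k) *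
      (bernoulli (2 * k) : ℝ) / (2 * k).factorial
      = (2 * Real.pi) ^ (2 * k) / 2 * (|(bernoulli (2 * k) : ℝ)| / (2 * k).factorial) := by
    rw [← abs_of_pos (lt_of_lt_of_le one_pos h1)]
    simp only [abs_div, abs_mul, abs_pow, abs_neg, abs_one, one_pow, one_mul, Nat.abs_ofNat,
      Nat.abs_cast, abs_of_pos Real.pi_pos]
    obtain ⟨m, rfl⟩ := Nat.exists_eq_succ_of_ne_zero hk
    rw [show 2 * (m.succ) - 1 = 2 * m + 1 by omega, show 2 * m.succ = 2 * m + 2 by omega]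
    ring
  rw [habs] at h1 h2
  constructor
  · rw [div_le_iff₀ hpos]; linarith
  · rw [le_div_iff₀ hpos]; linarith

theorem norm_bernoulli_div_factorial_le (n : ℕ) :
    ‖((bernoulli n : ℚ) : ℂ) / (n.factorial : ℂ)‖ ≤ 4 / (2 * Real.pi) ^ n := by
  have hn : ‖((bernoulli n : ℚ) : ℂ) / (n.factorial : ℂ)‖
      = |(bernoulli n : ℝ)| / n.factorial := by
    rw [norm_div, Complex.norm_natCast, ← Complex.ofReal_ratCast, Complex.norm_real,
      Real.norm_eq_abs]
  rw [hn]
  rcases Nat.even_or_odd' n with ⟨k, rfl | rfl⟩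
  · rcases eq_or_ne k 0 with rfl | hk
    · simp
    · exact (abs_bernoulli_two_mul_bounds hk).2
  · rcases Nat.eq_zero_or_pos k with rfl | hk
    · have := Real.pi_lt_d2
      have := Real.pi_pos
      simp only [mul_zero, zero_add, bernoulli_one, Nat.factorial_one, pow_one]
      rw [le_div_iff₀ (by positivity)]
      norm_num [abs_div]
      linarith
    · rw [bernoulli_eq_zero_of_odd ⟨k, rfl⟩ (by omega)]
      simp
      positivity

theorem summable_norm_bernoulli_series {z : ℂ} (hz : ‖z‖ < 2 * Real.pi) :
    Summable fun n : ℕ => ‖((bernoulli n : ℚ) : ℂ) / (n.factorial : ℂ) * z ^ n‖ := by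
  have h : Summable fun n : ℕ => 4 * (‖z‖ / (2 * Real.pi)) ^ n :=
    (summable_geometric_of_lt_one (by positivity)
      ((div_lt_one (by positivity)).2 hz)).mul_left 4
  refine h.of_nonneg_of_le (fun n => norm_nonneg _) fun n => ?_
  rw [norm_mul, norm_pow, div_pow]
  calc _ ≤ 4 / (2 * Real.pi) ^ n * ‖z‖ ^ n :=
        mul_le_mul_of_nonneg_right (norm_bernoulli_div_factorial_le n) (by positivity)
    _ = _ := by ring

/-- The sum of the exponential generating series of the Bernoulli numbers. -/
noncomputable def bernoulliGen (z : ℂ) : ℂ :=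
  ∑' n : ℕ, ((bernoulli n : ℚ) : ℂ) / (n.factorial : ℂ) * z ^ n

theorem hasSum_bernoulliGen {z : ℂ} (hz : ‖z‖ < 2 * Real.pi) :
    HasSum (fun n : ℕ => ((bernoulli n : ℚ) : ℂ) / (n.factorial : ℂ) * z ^ n)
      (bernoulliGen z) :=
  (summable_norm_bernoulli_series hz).of_norm.hasSum

/-- Both series converge absolutely, so their Cauchy product may be formed; its coefficients are
those of the formal identity `bernoulliPowerSeries_mul_exp_sub_one`. -/
theorem bernoulliGen_mul_exp_sub_one {z : ℂ} (hz : ‖z‖ < 2 * Real.pi) :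
    bernoulliGen z * (Complex.exp z - 1) = z := by
  set e : ℕ → ℂ := fun n => (if n = 0 then 0 else (1 : ℂ) / n.factorial) * z ^ n with he
  have hexp : HasSum (fun n : ℕ => z ^ n / (n.factorial : ℂ)) (Complex.exp z) := by
    rw [Complex.exp_eq_exp_ℂ]; exact NormedSpace.expSeries_div_hasSum_exp z
  have hexp' : Summable fun n : ℕ => ‖z ^ n / (n.factorial : ℂ)‖ :=
    NormedSpace.norm_expSeries_div_summable z
  have heq : ∀ n, e n = z ^ n / (n.factorial : ℂ) - if n = 0 then 1 else 0 := by
    intro n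
    rcases eq_or_ne n 0 with rfl | hn
    · simp [he]
    · simp [he, hn]; ring
  have hesum : HasSum e (Complex.exp z - 1) := by
    have := hexp.sub (hasSum_ite_eq (0 : ℕ) (1 : ℂ))
    exact this.congr_fun heq
  have henorm : Summable fun n => ‖e n‖ := by
    refine hexp'.of_nonneg_of_le (fun n => norm_nonneg _) fun n => ?_
    rcases eq_or_ne n 0 with rfl | hn
    · simp [he]
    · rw [heq n]; simp [hn]
  rw [← hesum.tsum_eq, bernoulliGen,
    tsum_mul_tsum_eq_tsum_sum_antidiagonal_of_summable_norm
      (summable_norm_bernoulli_series hz) henorm]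
  have hcoeff : ∀ n : ℕ, ∑ kl ∈ Finset.HasAntidiagonal.antidiagonal n,
      ((bernoulli kl.1 : ℚ) : ℂ) / (kl.1.factorial : ℂ) * z ^ kl.1 * e kl.2
      = (if n = 1 then z else 0) := by
    intro n
    have h := congrArg (PowerSeries.coeff n) (bernoulliPowerSeries_mul_exp_sub_one ℂ)
    rw [PowerSeries.coeff_mul, PowerSeries.coeff_X] at h
    have h2 : ∑ kl ∈ Finset.HasAntidiagonal.antidiagonal n,
      ((bernoulli kl.1 : ℚ) : ℂ) / (kl.1.factorial : ℂ) * z ^ kl.1 * e kl.2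
        = (if n = 1 then 1 else 0) * z ^ n := by
      rw [← h, Finset.sum_mul]
      refine Finset.sum_congr rfl fun kl hkl => ?_
      rw [← Finset.HasAntidiagonal.mem_antidiagonal.1 hkl, pow_add]
      simp only [he, bernoulliPowerSeries, PowerSeries.coeff_mk, map_sub, PowerSeries.coeff_exp,
        PowerSeries.coeff_one]
      rcases eq_or_ne kl.2 0 with h0 | h0
      · simp [h0]
      · simp [h0]; ring
    rw [h2]
    split_ifs with h1
    · simp [h1]
    · simp
  simp_rw [hcoeff]
  rw [tsum_ite_eq]

/-- With `x = exp z`, `4z/(x⁴ - 1) - 2z/(x² - 1) = -2z/(x² + 1)`, while `tanh z - 1 = -2/(x² + 1)`.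
For `z ≠ 0` the preceding identity itself shows that the denominators do not vanish. -/
theorem mul_tanh_eq_bernoulliGen {z : ℂ} (hz : ‖z‖ < Real.pi / 2) :
    bernoulliGen (4 * z) - bernoulliGen (2 * z) = z * Complex.tanh z - z := by
  have hpi := Real.pi_pos
  have h4 : ‖4 * z‖ < 2 * Real.pi := by rw [norm_mul]; norm_num; linarith
  have h2 : ‖2 * z‖ < 2 * Real.pi := by rw [norm_mul]; norm_num; linarith
  have e4 := bernoulliGen_mul_exp_sub_one h4
  have e2 := bernoulliGen_mul_exp_sub_one h2
  rcases eq_or_ne z 0 with rfl | hz0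
  · simp
  have hE : Complex.exp (4 * z) = Complex.exp z ^ 4 := by
    rw [← Complex.exp_nat_mul]; norm_num
  have hE2 : Complex.exp (2 * z) = Complex.exp z ^ 2 := by
    rw [← Complex.exp_nat_mul]; norm_num
  rw [hE] at e4
  rw [hE2] at e2
  have hx := Complex.exp_ne_zero z
  rw [Complex.tanh_eq_sinh_div_cosh, Complex.sinh, Complex.cosh, Complex.exp_neg]
  generalize Complex.exp z = x at *
  have n4 : x ^ 4 - 1 ≠ 0 := by
    intro h; rw [h, mul_zero] at e4
    exact hz0 (by simpa using e4.symm)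
  have n2 : x ^ 2 - 1 ≠ 0 := by
    intro h; rw [h, mul_zero] at e2
    exact hz0 (by simpa using e2.symm)
  have np : x ^ 2 + 1 ≠ 0 := by
    intro h; apply n4; linear_combination (x ^ 2 - 1) * h
  rw [eq_div_of_mul_eq n4 e4, eq_div_of_mul_eq n2 e2]
  have h3 : (x - x⁻¹) / 2 / ((x + x⁻¹) / 2) = (x ^ 2 - 1) / (x ^ 2 + 1) := by
    field_simp
  rw [h3, show x ^ 4 - 1 = (x ^ 2 - 1) * (x ^ 2 + 1) by ring]
  field_simp
  ring

theorem hasSum_mul_tanh {z : ℂ} (hz : ‖z‖ < Real.pi / 2) :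
    HasSum (fun k : ℕ => ((4 : ℂ) ^ k * (4 ^ k - 1)) *
      (((bernoulli (2 * k) : ℚ) : ℂ) / ((2 * k).factorial : ℂ)) * z ^ (2 * k))
      (z * Complex.tanh z) := by
  have hpi := Real.pi_pos
  have h4 : ‖4 * z‖ < 2 * Real.pi := by rw [norm_mul]; norm_num; linarith
  have h2 : ‖2 * z‖ < 2 * Real.pi := by rw [norm_mul]; norm_num; linarith
  -- The series concentrated at index `1` cancels the term of `B₁ = -1/2`, the only odd one that is
  -- nonzero, so that the sum can be reindexed by `2k`.
  have h := ((hasSum_bernoulliGen h4).sub (hasSum_bernoulliGen h2)).add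
    (hasSum_ite_eq (1 : ℕ) z)
  rw [mul_tanh_eq_bernoulliGen hz, sub_add_cancel] at h
  have hinj : Function.Injective fun k : ℕ => 2 * k := fun a b h => by simpa using h
  rw [← hinj.hasSum_iff] at h
  · refine h.congr_fun fun k => ?_
    have : 2 * k ≠ 1 := by omega
    simp only [Function.comp, this, if_false, add_zero]
    rw [mul_pow, mul_pow, pow_mul (4 : ℂ), pow_mul (2 : ℂ), show (4 : ℂ) ^ 2 = 4 * 4 by norm_num,
      show (2 : ℂ) ^ 2 = 4 by norm_num, mul_pow]
    ring
  · intro n hn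
    have hodd : Odd n := by
      rcases Nat.even_or_odd' n with ⟨k, rfl | rfl⟩
      · exact absurd ⟨k, rfl⟩ hn
      · exact ⟨k, rfl⟩
    rcases eq_or_ne n 1 with rfl | hn1
    · simp [bernoulli_one]; ring
    · rw [bernoulli_eq_zero_of_odd hodd (by rcases hodd with ⟨k, rfl⟩; omega)]
      simp [hn1]

/-- The terms do not tend to zero. The lower bound on `B_{2k}/(2k)!`, together with `4^k/(2k) ≤
(2k)!/(k!)²` and `4^k/2 ≤ 4^k - 1`, makes them at least a constant times `r^{2k}/k` with `r =
2b‖s‖/π > 1`. -/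
theorem not_tendsto_sum_smallTerm {b : ℝ} (hb : 0 < b) {s : ℂ} (hs : Real.pi / (2 * b) < ‖s‖) :
    ¬ ∃ S : ℂ, Tendsto (fun n : ℕ => ∑ j ∈ Finset.range n, smallTerm b s (j + 2))
      atTop (𝓝 S) := by
  rintro ⟨S, hS⟩
  have hpi := Real.pi_pos
  have hterm : Tendsto (fun n : ℕ => ‖smallTerm b s (n + 2)‖) atTop (𝓝 0) := by
    have := ((tendsto_add_atTop_iff_nat 1).2 hS).sub hS
    simp only [Finset.sum_range_succ, add_sub_cancel_left, sub_self] at this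
    simpa using this.norm
  set r : ℝ := 2 * b * ‖s‖ / Real.pi with hr
  have hs0 : 0 < ‖s‖ := lt_of_le_of_lt (by positivity) hs
  have hr1 : 1 < r := by
    rw [hr, one_lt_div hpi]
    rw [div_lt_iff₀ (by positivity)] at hs
    linarith
  -- lower bound of the terms
  have hlow : ∀ n : ℕ, b ^ 2 / (b * ‖s‖) ^ 4 * ((r ^ 2) ^ (n + 2) / ((n + 2 : ℕ) : ℝ) ^ 1) ≤
      ‖smallTerm b s (n + 2)‖ := by
    intro n
    set k := n + 2 with hk
    have hk0 : k ≠ 0 := by omega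
    have hB := (abs_bernoulli_two_mul_bounds hk0).1
    have hk' : (0 : ℝ) < k := by positivity
    have hnorm : ‖smallTerm b s k‖ = 2 * b ^ 2 * ((4 ^ k - 1) *
        |(bernoulli (2 * k) : ℝ)| / (k.factorial : ℝ) ^ 2 * (b * ‖s‖) ^ (2 * k - 4)) := by
      unfold smallTerm
      have : ‖(2 : ℂ) ^ (2 * k) - 1‖ = 4 ^ k - 1 := by
        have h4 : (1 : ℝ) ≤ 4 ^ k := one_le_pow₀ (by norm_num)
        rw [show (2 : ℂ) ^ (2 * k) - 1 = (((4 : ℝ) ^ k - 1 : ℝ) : ℂ) by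
          rw [pow_mul]; push_cast; norm_num]
        rw [Complex.norm_real, Real.norm_of_nonneg (by linarith)]
      simp only [norm_mul, norm_div, norm_pow, norm_neg, Complex.norm_natCast, this,
        Complex.norm_real, Real.norm_of_nonneg hb.le]
      rw [← Complex.ofReal_ratCast, Complex.norm_real, Real.norm_eq_abs]
      norm_num
    rw [hnorm]
    have hfac : (0 : ℝ) < (k.factorial : ℝ) ^ 2 := by positivity
    have hfac2 : (0 : ℝ) < ((2 * k).factorial : ℝ) := by positivity
    have hcb : (4 : ℝ) ^ k / (2 * k) ≤ ((2 * k).factorial : ℝ) / (k.factorial : ℝ) ^ 2 := by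
      have h1 := Nat.four_pow_le_two_mul_self_mul_centralBinom k (by omega)
      have h2 : (k.centralBinom : ℝ) = ((2 * k).factorial : ℝ) / (k.factorial : ℝ) ^ 2 := by
        rw [Nat.centralBinom_eq_two_mul_choose, Nat.cast_choose ℝ (by omega : k ≤ 2 * k),
          show 2 * k - k = k by omega, sq]
      rw [← h2, div_le_iff₀ (by positivity)]
      have : ((4 ^ k : ℕ) : ℝ) ≤ ((2 * k * k.centralBinom : ℕ) : ℝ) := by exact_mod_cast h1
      push_cast at this
      linarith
    have h4 : (4 : ℝ) ^ k / 2 ≤ 4 ^ k - 1 := by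
      have : (2 : ℝ) ≤ 4 ^ k := by
        calc (2 : ℝ) ≤ 4 ^ 1 := by norm_num
          _ ≤ 4 ^ k := pow_le_pow_right₀ (by norm_num) (by omega)
      linarith
    have hsplit : (b * ‖s‖) ^ (2 * k - 4) = (b * ‖s‖) ^ (2 * k) / (b * ‖s‖) ^ 4 := by
      rw [eq_div_iff (by positivity), ← pow_add]
      congr 1
    calc b ^ 2 / (b * ‖s‖) ^ 4 * ((r ^ 2) ^ k / (k : ℝ) ^ 1)
        = 2 * b ^ 2 * ((4 ^ k / 2) * ((2 / (2 * Real.pi) ^ (2 * k)) * (4 ^ k / (2 * k)))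
          * ((b * ‖s‖) ^ (2 * k) / (b * ‖s‖) ^ 4)) := by
          rw [hr, ← pow_mul]
          have e1 : (4 : ℝ) ^ k = 2 ^ (2 * k) := by rw [pow_mul]; norm_num
          rw [e1, div_pow, mul_pow, mul_pow, mul_pow]
          field_simp
          ring
      _ ≤ 2 * b ^ 2 * ((4 ^ k - 1) * ((|(bernoulli (2 * k) : ℝ)| / (2 * k).factorial) *
          (((2 * k).factorial : ℝ) / (k.factorial : ℝ) ^ 2))
          * ((b * ‖s‖) ^ (2 * k) / (b * ‖s‖) ^ 4)) := by
          have : (0 : ℝ) ≤ 4 ^ k - 1 := le_trans (by positivity) h4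
          gcongr
      _ = _ := by
          rw [hsplit]
          field_simp
  have hr2 : 1 < r ^ 2 := one_lt_pow₀ hr1 (by norm_num)
  have hinf : Tendsto (fun n : ℕ => b ^ 2 / (b * ‖s‖) ^ 4 *
      ((r ^ 2) ^ (n + 2) / ((n + 2 : ℕ) : ℝ) ^ 1)) atTop atTop := by
    have hc : 0 < b ^ 2 / (b * ‖s‖) ^ 4 := by positivity
    have h := (tendsto_add_atTop_iff_nat 2).2 (tendsto_pow_const_div_const_pow_of_one_lt 1 hr2)
    have h' : Tendsto (fun n : ℕ => ((r ^ 2) ^ (n + 2) / ((n + 2 : ℕ) : ℝ) ^ 1)) atTop atTop := by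
      have h0 : Tendsto (fun n : ℕ => ((n + 2 : ℕ) : ℝ) ^ 1 / (r ^ 2) ^ (n + 2)) atTop
          (𝓝[>] 0) := by
        refine tendsto_nhdsWithin_iff.2 ⟨h, Eventually.of_forall fun n => ?_⟩
        have : 0 < r := by linarith
        simp only [mem_Ioi]; positivity
      refine h0.inv_tendsto_nhdsGT_zero.congr fun n => ?_
      simp
    exact h'.const_mul_atTop hc
  exact not_tendsto_nhds_of_tendsto_atTop (tendsto_atTop_mono hlow hinf) 0 hterm

/-! ### The disk and its vertical sections -/

theorem mem_diskDomain_iff_abs_lt {b x y : ℝ} :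
    (x, y) ∈ diskDomain b ↔ |y| < √(b ^ 2 - x ^ 2) := by
  rw [Real.lt_sqrt (abs_nonneg _), sq_abs]
  simp only [diskDomain, mem_ofPred_eq]
  constructor <;> intro h <;> linarith

theorem isOpen_diskDomain (b : ℝ) : IsOpen (diskDomain b) :=
  isOpen_lt (by fun_prop) (by fun_prop)

theorem diskDomain_subset_Icc {b : ℝ} (hb : 0 < b) :
    diskDomain b ⊆ Icc ((-b, -b) : ℝ × ℝ) (b, b) := by
  rintro ⟨x, y⟩ h
  simp only [diskDomain, mem_ofPred_eq] at h
  have hx := abs_lt_of_sq_lt_sq (show x ^ 2 < b ^ 2 by nlinarith [sq_nonneg y]) hb.le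
  have hy := abs_lt_of_sq_lt_sq (show y ^ 2 < b ^ 2 by nlinarith [sq_nonneg x]) hb.le
  rw [abs_lt] at hx hy
  exact ⟨Prod.mk_le_mk.2 ⟨hx.1.le, hy.1.le⟩, Prod.mk_le_mk.2 ⟨hx.2.le, hy.2.le⟩⟩

theorem volume_diskDomain_lt_top {b : ℝ} (hb : 0 < b) : volume (diskDomain b) < ⊤ :=
  lt_of_le_of_lt (measure_mono (diskDomain_subset_Icc hb)) isCompact_Icc.measure_lt_top

theorem isCompact_closedDisk {b : ℝ} (hb : 0 < b) :
    IsCompact {p : ℝ × ℝ | p.1 ^ 2 + p.2 ^ 2 ≤ b ^ 2} := by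
  refine IsCompact.of_isClosed_subset isCompact_Icc (isClosed_le (by fun_prop) (by fun_prop))
    (?_ : _ ⊆ Icc ((-b, -b) : ℝ × ℝ) (b, b))
  rintro ⟨x, y⟩ h
  simp only [mem_ofPred_eq] at h
  have hx := abs_le.1 <| abs_le_of_sq_le_sq (show x ^ 2 ≤ b ^ 2 by nlinarith [sq_nonneg y]) hb.le
  have hy := abs_le.1 <| abs_le_of_sq_le_sq (show y ^ 2 ≤ b ^ 2 by nlinarith [sq_nonneg x]) hb.le
  exact ⟨Prod.mk_le_mk.2 ⟨hx.1, hy.1⟩, Prod.mk_le_mk.2 ⟨hx.2, hy.2⟩⟩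

/-- Fubini over vertical chords. The outer variable may run over all of `ℝ`, since `√` is `0` on
negative numbers and the chord degenerates for `|x| ≥ b`. -/
theorem setIntegral_diskDomain {b : ℝ} {f : ℝ × ℝ → ℂ}
    (hf : IntegrableOn f (diskDomain b)) :
    ∫ p in diskDomain b, f p
      = ∫ x, ∫ y in (-√(b ^ 2 - x ^ 2))..√(b ^ 2 - x ^ 2), f (x, y) := by
  have hm : MeasurableSet (diskDomain b) := (isOpen_diskDomain b).measurableSet
  rw [← integral_indicator hm, Measure.volume_eq_prod, integral_prod]
  · congr 1
    ext x
    rw [intervalIntegral.integral_of_le (by linarith [Real.sqrt_nonneg (b ^ 2 - x ^ 2)]),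
      integral_Ioc_eq_integral_Ioo, ← integral_indicator measurableSet_Ioo]
    congr 1
    ext y
    by_cases h : (x, y) ∈ diskDomain b
    · rw [indicator_of_mem h, indicator_of_mem]
      exact abs_lt.1 (mem_diskDomain_iff_abs_lt.1 h)
    · rw [indicator_of_notMem h, indicator_of_notMem]
      exact fun h' => h (mem_diskDomain_iff_abs_lt.2 (abs_lt.2 h'))
  · rw [← Measure.volume_eq_prod]
    exact (integrable_indicator_iff hm).2 hf

/-- The substitution `x = b sin φ`; `g 0 = 0` removes the contribution of `|x| ≥ b`. -/
theorem integral_comp_sqrt_sub_sq {b : ℝ} (hb : 0 < b) {g : ℝ → ℂ} (hg0 : g 0 = 0)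
    (hg : ContinuousOn g (Icc 0 b)) :
    ∫ x, g √(b ^ 2 - x ^ 2)
      = ∫ φ in (-(Real.pi / 2))..(Real.pi / 2), g (b * Real.cos φ) * (b * Real.cos φ : ℝ) := by
  have hpi := Real.pi_pos
  have h1 : ∫ x, g √(b ^ 2 - x ^ 2) = ∫ x in (-b)..b, g √(b ^ 2 - x ^ 2) := by
    rw [intervalIntegral.integral_of_le (by linarith), setIntegral_eq_integral_of_forall_compl_eq_zero]
    intro x hx
    have : b ^ 2 - x ^ 2 ≤ 0 := by
      by_contra! h
      have := abs_lt.1 (abs_lt_of_sq_lt_sq (show x ^ 2 < b ^ 2 by linarith) hb.le)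
      exact hx ⟨this.1, this.2.le⟩
    rw [Real.sqrt_eq_zero_of_nonpos this, hg0]
  have hmaps : MapsTo (fun x : ℝ => √(b ^ 2 - x ^ 2)) univ (Icc 0 b) := fun x _ =>
    ⟨Real.sqrt_nonneg _, (Real.sqrt_le_left hb.le).2 (by nlinarith [sq_nonneg x])⟩
  have hcont : ContinuousOn (fun x : ℝ => g √(b ^ 2 - x ^ 2)) univ :=
    hg.comp (by fun_prop) hmaps
  have h3 := intervalIntegral.integral_deriv_smul_comp (a := -(Real.pi / 2)) (b := Real.pi / 2)
    (f := fun φ => b * Real.sin φ) (f' := fun φ => b * Real.cos φ)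
    (g := fun x : ℝ => g √(b ^ 2 - x ^ 2))
    (fun φ _ => (Real.hasDerivAt_sin φ).const_mul b) (by fun_prop)
    (continuousOn_univ.1 hcont)
  simp only [Real.sin_neg, Real.sin_pi_div_two, mul_one, mul_neg] at h3
  rw [h1, ← h3]
  refine intervalIntegral.integral_congr fun φ hφ => ?_
  rw [uIcc_of_le (by linarith)] at hφ
  have hc : 0 ≤ Real.cos φ := Real.cos_nonneg_of_mem_Icc hφ
  have : √(b ^ 2 - (b * Real.sin φ) ^ 2) = b * Real.cos φ := by
    rw [show b ^ 2 - (b * Real.sin φ) ^ 2 = (b * Real.cos φ) ^ 2 by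
      have := Real.sin_sq_add_cos_sq φ; linear_combination (-b ^ 2) * this]
    exact Real.sqrt_sq (by positivity)
  simp only [Function.comp, this, Complex.real_smul]
  rw [mul_comm]

theorem volume_real_diskDomain {b : ℝ} (hb : 0 < b) :
    volume.real (diskDomain b) = Real.pi * b ^ 2 := by
  have h := setIntegral_diskDomain (b := b) (f := fun _ => (1 : ℂ))
    (integrableOn_const (volume_diskDomain_lt_top hb).ne)
  have h2 := integral_comp_sqrt_sub_sq hb (g := fun t : ℝ => ((2 * t : ℝ) : ℂ)) (by simp)
    (by fun_prop)
  have h3 : ∀ x : ℝ, ∫ y in (-√(b ^ 2 - x ^ 2))..√(b ^ 2 - x ^ 2), (1 : ℂ)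
      = ((2 * √(b ^ 2 - x ^ 2) : ℝ) : ℂ) := by
    intro x
    rw [intervalIntegral.integral_const]
    simp; ring
  simp_rw [h3] at h
  rw [h2] at h
  have h4 : ∫ φ in (-(Real.pi / 2))..(Real.pi / 2),
      ((2 * (b * Real.cos φ) : ℝ) : ℂ) * ((b * Real.cos φ : ℝ) : ℂ)
      = ((Real.pi * b ^ 2 : ℝ) : ℂ) := by
    have : ∀ φ : ℝ, ((2 * (b * Real.cos φ) : ℝ) : ℂ) * ((b * Real.cos φ : ℝ) : ℂ)
        = ((2 * b ^ 2 * Real.cos φ ^ 2 : ℝ) : ℂ) := by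
      intro φ; push_cast; ring
    simp_rw [this]
    rw [intervalIntegral.integral_ofReal, intervalIntegral.integral_const_mul, integral_cos_sq]
    simp; ring
  rw [h4] at h
  simp only [integral_const, measureReal_restrict_apply_univ, Complex.real_smul, mul_one] at h
  exact_mod_cast h

/-! ### The equation on a vertical section -/

/-- The solution of `f'' = s² f` with `f 0 = 0`, `f' 0 = 1`. -/
noncomputable def sinhDiv (s : ℂ) (y : ℝ) : ℂ :=
  if s = 0 then (y : ℂ) else Complex.sinh (s * y) / s

/-- The primitive of `sinhDiv s` that vanishes at `0`. -/
noncomputable def coshSubOneDiv (s : ℂ) (y : ℝ) : ℂ :=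
  if s = 0 then (y : ℂ) ^ 2 / 2 else (Complex.cosh (s * y) - 1) / s ^ 2

theorem hasDerivAt_cosh_mul (s : ℂ) (y : ℝ) :
    HasDerivAt (fun t : ℝ => Complex.cosh (s * t)) (s ^ 2 * sinhDiv s y) y := by
  have h0 : HasDerivAt (fun t : ℝ => s * (t : ℂ)) s y := by
    simpa using (Complex.ofRealCLM.hasDerivAt (x := y)).const_mul s
  have h := (Complex.hasDerivAt_cosh (s * y)).comp y h0
  refine h.congr_deriv ?_
  unfold sinhDiv
  split_ifs with hs
  · simp [hs]
  · field_simp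

theorem hasDerivAt_sinhDiv (s : ℂ) (y : ℝ) :
    HasDerivAt (sinhDiv s) (Complex.cosh (s * y)) y := by
  unfold sinhDiv
  split_ifs with hs
  · refine (Complex.ofRealCLM.hasDerivAt (x := y)).congr_deriv ?_
    simp [hs]
  · have h0 : HasDerivAt (fun t : ℝ => s * (t : ℂ)) s y := by
      simpa using (Complex.ofRealCLM.hasDerivAt (x := y)).const_mul s
    have h := ((Complex.hasDerivAt_sinh (s * y)).comp y h0).div_const s
    refine h.congr_deriv ?_
    field_simp

theorem hasDerivAt_coshSubOneDiv (s : ℂ) (y : ℝ) :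
    HasDerivAt (coshSubOneDiv s) (sinhDiv s y) y := by
  rcases eq_or_ne s 0 with rfl | hs
  · have h := ((Complex.ofRealCLM.hasDerivAt (x := y)).pow 2).div_const 2
    have e : coshSubOneDiv 0 = fun t : ℝ => (t : ℂ) ^ 2 / 2 := by
      ext t; simp [coshSubOneDiv]
    rw [e]
    refine h.congr_deriv ?_
    simp [sinhDiv]
  · have h := ((hasDerivAt_cosh_mul s y).sub_const 1).div_const (s ^ 2)
    have e : coshSubOneDiv s = fun t : ℝ => (Complex.cosh (s * t) - 1) / s ^ 2 := by
      ext t; simp [coshSubOneDiv, hs]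
    rw [e]
    refine h.congr_deriv ?_
    field_simp

theorem cosh_eq_one_add (s : ℂ) (y : ℝ) :
    Complex.cosh (s * y) = 1 + s ^ 2 * coshSubOneDiv s y := by
  unfold coshSubOneDiv
  split_ifs with hs
  · simp [hs]
  · field_simp; ring

theorem cosh_sq_sub (s : ℂ) (y : ℝ) :
    Complex.cosh (s * y) ^ 2 - s ^ 2 * sinhDiv s y ^ 2 = 1 := by
  rw [← Complex.cosh_sq_sub_sinh_sq (s * y)]
  unfold sinhDiv
  split_ifs with hs
  · simp [hs]
  · field_simp

theorem sinhDiv_neg (s : ℂ) (y : ℝ) : sinhDiv s (-y) = -sinhDiv s y := by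
  unfold sinhDiv; split_ifs <;> simp [neg_div]

theorem coshSubOneDiv_neg (s : ℂ) (y : ℝ) : coshSubOneDiv s (-y) = coshSubOneDiv s y := by
  unfold coshSubOneDiv; split_ifs <;> simp

@[simp] theorem sinhDiv_zero (s : ℂ) : sinhDiv s 0 = 0 := by
  unfold sinhDiv; split_ifs <;> simp

theorem contDiff_cosh_mul (s : ℂ) {n : WithTop ℕ∞} :
    ContDiff ℝ n fun t : ℝ => Complex.cosh (s * t) :=
  Complex.contDiff_cosh.restrict_scalars ℝ |>.comp
    (contDiff_const.mul Complex.ofRealCLM.contDiff)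

theorem contDiff_sinhDiv (s : ℂ) {n : WithTop ℕ∞} : ContDiff ℝ n (sinhDiv s) := by
  unfold sinhDiv
  split_ifs
  · exact Complex.ofRealCLM.contDiff
  · exact (Complex.contDiff_sinh.restrict_scalars ℝ |>.comp
      (contDiff_const.mul Complex.ofRealCLM.contDiff)).div_const s

theorem contDiff_coshSubOneDiv (s : ℂ) {n : WithTop ℕ∞} : ContDiff ℝ n (coshSubOneDiv s) := by
  unfold coshSubOneDiv
  split_ifs
  · exact (Complex.ofRealCLM.contDiff.pow 2).div_const 2
  · exact ((contDiff_cosh_mul s).sub contDiff_const).div_const _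

/-- A zero forces `s t = iπ(k + 1/2)` up to sign, hence `s` imaginary with `|Im s| t ≥ π/2`. As `t ≤
b`, this puts `s` on a cut. -/
theorem cosh_ne_zero_of_notMem_cuts {b : ℝ} {s : ℂ} (hs : s ∉ imaginaryCuts b)
    {t : ℝ} (ht0 : 0 ≤ t) (htb : t ≤ b) : Complex.cosh (s * t) ≠ 0 := by
  intro h
  have hpi := Real.pi_pos
  rw [← Complex.cos_mul_I, Complex.cos_eq_zero_iff] at h
  obtain ⟨k, hk⟩ := h
  have hre := congrArg Complex.re hk
  have him := congrArg Complex.im hk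
  have e : ((2 * (k : ℂ) + 1) * (Real.pi : ℂ) / 2) = (((2 * k + 1) * Real.pi / 2 : ℝ) : ℂ) := by
    push_cast; ring
  rw [e] at hre him
  simp at hre him
  have hk1 : (1 : ℝ) ≤ |2 * (k : ℝ) + 1| := by
    have : (1 : ℤ) ≤ |2 * k + 1| := Int.one_le_abs (by omega)
    exact_mod_cast this
  have habs : Real.pi / 2 ≤ |s.im| * t := by
    have := congrArg abs hre
    rw [abs_neg, abs_mul, abs_of_nonneg ht0, abs_div, abs_mul, abs_of_pos hpi, abs_two] at this
    rw [this]
    nlinarith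
  have ht : 0 < t := by
    rcases ht0.eq_or_lt with h0 | h0
    · rw [← h0] at habs; linarith
    · exact h0
  have hb : 0 < b := ht.trans_le htb
  refine hs ⟨?_, ?_⟩
  · rcases him with h | h
    · exact h
    · exact absurd h ht.ne'
  · rw [div_le_iff₀ (by positivity)]
    nlinarith [abs_nonneg s.im]

theorem sinhDiv_ne_zero_of_notMem_cuts {b : ℝ} {s : ℂ} (hs : s ∉ imaginaryCuts b)
    {t : ℝ} (ht0 : 0 < t) (htb : t ≤ b) : sinhDiv s t ≠ 0 := by
  rcases eq_or_ne s 0 with rfl | hs0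
  · simpa [sinhDiv] using ht0.ne'
  simp only [sinhDiv, hs0, if_false]
  refine div_ne_zero (fun h => ?_) hs0
  have hst : s * (t : ℂ) ≠ 0 := mul_ne_zero hs0 (by exact_mod_cast ht0.ne')
  have h' : Complex.sin (s * t * Complex.I) = 0 := by rw [Complex.sin_mul_I, h, zero_mul]
  obtain ⟨k, hk⟩ := Complex.sin_eq_zero_iff.1 h'
  have hk0 : k ≠ 0 := by
    rintro rfl
    simp [hst] at hk
  have hk1 : (1 : ℝ) ≤ |(k : ℝ)| := by exact_mod_cast Int.one_le_abs hk0
  -- A zero of `sinh` at `s t = ∓iπk` gives a zero of `cosh` at the shorter height `t/(2|k|)`, where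
  -- the argument is `±iπ/2`.
  refine cosh_ne_zero_of_notMem_cuts hs (t := t / (2 * |(k : ℝ)|)) (by positivity) ?_ ?_
  · refine le_trans (div_le_self ht0.le (by linarith)) htb
  · have hkc : (k : ℂ) ≠ 0 := by exact_mod_cast hk0
    have key : Complex.cosh (s * ((t / (2 * k) : ℝ) : ℂ)) = 0 := by
      rw [← Complex.cos_mul_I, ← Complex.cos_pi_div_two]
      congr 1
      push_cast
      rw [show s * (t / (2 * k)) * Complex.I = (s * t * Complex.I) / (2 * k) by ring, hk]
      field_simp
    rcases abs_choice (k : ℝ) with hc | hc <;> rw [hc]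
    · exact key
    · rw [← key, ← Complex.cosh_neg]
      congr 1
      push_cast
      ring

/-- The Wronskians of `w` with `cosh(s t)` and `sinhDiv s` are constant, which forces `w = A cosh(s
t) + B sinhDiv s t`, also at the end points by continuity. The even and odd parts of the boundary
conditions then give `A = B = 0`. -/
theorem eq_zero_of_second_deriv_eq {s : ℂ} {Y : ℝ} (hY : 0 < Y) {w w' : ℝ → ℂ}
    (hw : ∀ t ∈ Ioo (-Y) Y, HasDerivAt w (w' t) t)
    (hw' : ∀ t ∈ Ioo (-Y) Y, HasDerivAt w' (s ^ 2 * w t) t)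
    (hc : ContinuousOn w (Icc (-Y) Y)) (h1 : w Y = 0) (h2 : w (-Y) = 0)
    (hC : Complex.cosh (s * Y) ≠ 0) (hS : sinhDiv s Y ≠ 0) :
    ∀ t ∈ Ioo (-Y) Y, w t = 0 := by
  have hconst : ∀ f : ℝ → ℂ, (∀ t ∈ Ioo (-Y) Y, HasDerivAt f 0 t) →
      ∀ t ∈ Ioo (-Y) Y, f t = f 0 := fun f hf t ht =>
    isOpen_Ioo.is_const_of_deriv_eq_zero isPreconnected_Ioo
      (fun x hx => (hf x hx).differentiableAt.differentiableWithinAt)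
      (fun x hx => (hf x hx).deriv) ht ⟨by linarith, hY⟩
  have hA := hconst (fun t => w t * Complex.cosh (s * t) - w' t * sinhDiv s t) fun t ht => by
    refine (((hw t ht).mul (hasDerivAt_cosh_mul s t)).sub
      ((hw' t ht).mul (hasDerivAt_sinhDiv s t))).congr_deriv ?_
    ring
  have hB := hconst (fun t => w' t * Complex.cosh (s * t) - w t * (s ^ 2 * sinhDiv s t))
    fun t ht => by
      refine (((hw' t ht).mul (hasDerivAt_cosh_mul s t)).sub
        ((hw t ht).mul ((hasDerivAt_sinhDiv s t).const_mul (s ^ 2)))).congr_deriv ?_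
      ring
  set A := w 0
  set B := w' 0
  simp only [Complex.ofReal_zero, mul_zero, Complex.cosh_zero, mul_one, sinhDiv_zero,
    sub_zero] at hA hB
  have hw_eq : EqOn w (fun t => A * Complex.cosh (s * t) + B * sinhDiv s t) (Ioo (-Y) Y) := by
    intro t ht
    have e := cosh_sq_sub s t
    simp only [A, B]
    linear_combination (Complex.cosh (s * t)) * hA t ht + sinhDiv s t * hB t ht - w t * e
  have hw_eq' : EqOn w (fun t => A * Complex.cosh (s * t) + B * sinhDiv s t) (Icc (-Y) Y) := by
    refine hw_eq.of_subset_closure hc ?_ Ioo_subset_Icc_self ?_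
    · exact ((continuous_const.mul (contDiff_cosh_mul s (n := 0)).continuous).add
        (continuous_const.mul (contDiff_sinhDiv s (n := 0)).continuous)).continuousOn
    · rw [closure_Ioo (by linarith)]
  have e1 := hw_eq' (right_mem_Icc.2 (by linarith))
  have e2 := hw_eq' (left_mem_Icc.2 (by linarith))
  simp only [h1, h2, sinhDiv_neg, Complex.ofReal_neg, mul_neg, Complex.cosh_neg] at e1 e2
  have hA0 : A = 0 := by
    have : A * Complex.cosh (s * Y) = 0 := by linear_combination -(e1 + e2) / 2
    exact (mul_eq_zero.1 this).resolve_right hC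
  have hB0 : B = 0 := by
    have : B * sinhDiv s Y = 0 := by linear_combination -(e1 - e2) / 2
    exact (mul_eq_zero.1 this).resolve_right hS
  intro t ht
  rw [hw_eq ht]
  simp [hA0, hB0]

/-! ### The leading term -/

/-- The explicit leading term, written so that `s = 0` is included. -/
noncomputable def leadingTerm (b : ℝ) (s : ℂ) (p : ℝ × ℝ) : ℂ :=
  (coshSubOneDiv s √(b ^ 2 - p.1 ^ 2) - coshSubOneDiv s p.2) /
    Complex.cosh (s * (√(b ^ 2 - p.1 ^ 2) : ℝ))

/-- The vertical derivative of the leading term. -/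
noncomputable def leadingTermY (b : ℝ) (s : ℂ) (p : ℝ × ℝ) : ℂ :=
  -sinhDiv s p.2 / Complex.cosh (s * (√(b ^ 2 - p.1 ^ 2) : ℝ))

theorem hasDerivAt_leadingTerm (b : ℝ) (s : ℂ) (x y : ℝ) :
    HasDerivAt (fun t => leadingTerm b s (x, t)) (leadingTermY b s (x, y)) y := by
  simp only [leadingTerm, leadingTermY]
  exact ((hasDerivAt_coshSubOneDiv s y).const_sub _).div_const _

theorem hasDerivAt_leadingTermY (b : ℝ) (s : ℂ) (x y : ℝ) :
    HasDerivAt (fun t => leadingTermY b s (x, t))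
      (-Complex.cosh (s * y) / Complex.cosh (s * (√(b ^ 2 - x ^ 2) : ℝ))) y := by
  simp only [leadingTermY]
  exact (hasDerivAt_sinhDiv s y).neg.div_const _

theorem sqrt_sub_sq_mem_Icc {b : ℝ} (hb : 0 < b) (x : ℝ) : √(b ^ 2 - x ^ 2) ∈ Icc 0 b :=
  ⟨Real.sqrt_nonneg _, (Real.sqrt_le_left hb.le).2 (by nlinarith [sq_nonneg x])⟩

theorem cosh_sqrt_ne_zero {b : ℝ} (hb : 0 < b) {s : ℂ} (hs : s ∉ imaginaryCuts b) (x : ℝ) :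
    Complex.cosh (s * (√(b ^ 2 - x ^ 2) : ℝ)) ≠ 0 :=
  cosh_ne_zero_of_notMem_cuts hs (sqrt_sub_sq_mem_Icc hb x).1 (sqrt_sub_sq_mem_Icc hb x).2

theorem leadingTerm_equation {b : ℝ} (hb : 0 < b) {s : ℂ} (hs : s ∉ imaginaryCuts b) (x y : ℝ) :
    -Complex.cosh (s * y) / Complex.cosh (s * (√(b ^ 2 - x ^ 2) : ℝ))
      - s ^ 2 * leadingTerm b s (x, y) = -1 := by
  have h := cosh_sqrt_ne_zero hb hs x
  unfold leadingTerm
  rw [cosh_eq_one_add s y]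
  field_simp
  rw [cosh_eq_one_add s √(b ^ 2 - x ^ 2)]
  ring

theorem continuous_leadingTerm {b : ℝ} (hb : 0 < b) {s : ℂ} (hs : s ∉ imaginaryCuts b) :
    Continuous (leadingTerm b s) := by
  unfold leadingTerm
  have hQ : Continuous (coshSubOneDiv s) := (contDiff_coshSubOneDiv s (n := 0)).continuous
  refine Continuous.div ?_ ?_ fun p => cosh_sqrt_ne_zero hb hs p.1
  · exact (hQ.comp (by fun_prop)).sub (hQ.comp continuous_snd)
  · exact (contDiff_cosh_mul s (n := 0)).continuous.comp
      (by fun_prop : Continuous fun p : ℝ × ℝ => √(b ^ 2 - p.1 ^ 2))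

theorem continuous_leadingTermY {b : ℝ} (hb : 0 < b) {s : ℂ} (hs : s ∉ imaginaryCuts b) :
    Continuous (leadingTermY b s) := by
  unfold leadingTermY
  refine Continuous.div ?_ ?_ fun p => cosh_sqrt_ne_zero hb hs p.1
  · exact ((contDiff_sinhDiv s (n := 0)).continuous.comp continuous_snd).neg
  · exact (contDiff_cosh_mul s (n := 0)).continuous.comp
      (by fun_prop : Continuous fun p : ℝ × ℝ => √(b ^ 2 - p.1 ^ 2))

theorem contDiffOn_leadingTerm {b : ℝ} (hb : 0 < b) {s : ℂ} (hs : s ∉ imaginaryCuts b)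
    {n : WithTop ℕ∞} : ContDiffOn ℝ n (leadingTerm b s) (diskDomain b) := by
  have hsq : ContDiffOn ℝ n (fun p : ℝ × ℝ => √(b ^ 2 - p.1 ^ 2)) (diskDomain b) := by
    refine ContDiffOn.sqrt (by fun_prop) ?_
    rintro ⟨x, y⟩ h
    simp only [diskDomain, mem_ofPred_eq] at h
    simp only
    nlinarith [sq_nonneg y]
  unfold leadingTerm
  simp only [div_eq_mul_inv]
  refine ContDiffOn.mul ?_ (ContDiffOn.inv ?_ fun p _ => cosh_sqrt_ne_zero hb hs p.1)
  · exact ((contDiff_coshSubOneDiv s).comp_contDiffOn hsq).sub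
      ((contDiff_coshSubOneDiv s).comp contDiff_snd).contDiffOn
  · exact (contDiff_cosh_mul s).comp_contDiffOn hsq

theorem isLeadingTerm_leadingTerm {b : ℝ} (hb : 0 < b) {s : ℂ} (hs : s ∉ imaginaryCuts b) :
    IsLeadingTerm b s (leadingTerm b s) where
  continuousOn := (continuous_leadingTerm hb hs).continuousOn
  contDiffOn x := by
    simp only [leadingTerm]
    exact ((contDiff_const.sub (contDiff_coshSubOneDiv s)).div_const _).contDiffOn
  equation x y _ := by
    have h : (deriv fun t => leadingTerm b s (x, t)) = fun t => leadingTermY b s (x, t) :=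
      funext fun t => (hasDerivAt_leadingTerm b s x t).deriv
    rw [h, (hasDerivAt_leadingTermY b s x y).deriv]
    exact leadingTerm_equation hb hs x y
  boundary x y h := by
    have : b ^ 2 - x ^ 2 = y ^ 2 := by linarith
    simp only [leadingTerm, this, Real.sqrt_sq_eq_abs]
    rcases abs_choice y with h | h <;> rw [h] <;> simp [coshSubOneDiv_neg]

/-- On each chord the difference solves the homogeneous ODE with zero end values, and neither
fundamental solution vanishes at the half-chord, which lies in `(0, b]`. -/
theorem IsLeadingTerm.eqOn {b : ℝ} (hb : 0 < b) {s : ℂ} (hs : s ∉ imaginaryCuts b)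
    {u v : ℝ × ℝ → ℂ} (hu : IsLeadingTerm b s u) (hv : IsLeadingTerm b s v) :
    EqOn u v (diskDomain b) := by
  rintro ⟨x, y⟩ hxy
  set Y := √(b ^ 2 - x ^ 2) with hYdef
  have hyY : |y| < Y := mem_diskDomain_iff_abs_lt.1 hxy
  have hY : 0 < Y := (abs_nonneg y).trans_lt hyY
  have hYsq : Y ^ 2 = b ^ 2 - x ^ 2 := Real.sq_sqrt (Real.sqrt_pos.1 hY).le
  have hset : {t : ℝ | x ^ 2 + t ^ 2 < b ^ 2} = Ioo (-Y) Y := by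
    ext t
    exact (mem_diskDomain_iff_abs_lt (b := b) (x := x)).trans abs_lt
  have hD : ∀ f : ℝ × ℝ → ℂ, IsLeadingTerm b s f → ∀ t ∈ Ioo (-Y) Y,
      HasDerivAt (fun t => f (x, t)) (deriv (fun t => f (x, t)) t) t ∧
      HasDerivAt (deriv fun t => f (x, t)) (s ^ 2 * f (x, t) - 1) t := by
    intro f hf t ht
    have hcd := hf.contDiffOn x
    rw [hset] at hcd
    have hnhds := isOpen_Ioo.mem_nhds ht
    refine ⟨((hcd t ht).contDiffAt hnhds).differentiableAt (by norm_num) |>.hasDerivAt, ?_⟩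
    have h1 : ContDiffOn ℝ 1 (deriv fun t => f (x, t)) (Ioo (-Y) Y) :=
      hcd.deriv_of_isOpen isOpen_Ioo (by norm_num)
    have h2 := (((h1 t ht).contDiffAt hnhds).differentiableAt (by norm_num)).hasDerivAt
    refine h2.congr_deriv ?_
    have heq := hf.equation x t (by rw [← hset] at ht; exact ht)
    linear_combination heq
  have hcont : ∀ f : ℝ × ℝ → ℂ, IsLeadingTerm b s f →
      ContinuousOn (fun t => f (x, t)) (Icc (-Y) Y) := fun f hf =>
    hf.continuousOn.comp (by fun_prop) fun t ht => by
      have := sq_le_sq' ht.1 ht.2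
      simp only [mem_ofPred_eq]
      linarith
  have hbd : ∀ f : ℝ × ℝ → ℂ, IsLeadingTerm b s f → f (x, Y) = 0 ∧ f (x, -Y) = 0 :=
    fun f hf => ⟨hf.boundary x Y (by linarith), hf.boundary x (-Y) (by rw [neg_sq]; linarith)⟩
  have hYb := (sqrt_sub_sq_mem_Icc hb x).2
  have := eq_zero_of_second_deriv_eq (s := s) hY (w := fun t => u (x, t) - v (x, t))
    (w' := fun t => deriv (fun t => u (x, t)) t - deriv (fun t => v (x, t)) t)
    (fun t ht => (hD u hu t ht).1.sub (hD v hv t ht).1)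
    (fun t ht => ((hD u hu t ht).2.sub (hD v hv t ht).2).congr_deriv (by ring))
    ((hcont u hu).sub (hcont v hv)) (by simp [hbd u hu, hbd v hv]) (by simp [hbd u hu, hbd v hv])
    (cosh_sqrt_ne_zero hb hs x) (sinhDiv_ne_zero_of_notMem_cuts hs hY hYb) y (abs_lt.1 hyY)
  exact sub_eq_zero.1 this

theorem exists_norm_sinhDiv_le (s : ℂ) (b : ℝ) :
    ∃ C : ℝ, 0 ≤ C ∧ ∀ t ∈ Icc (-b) b, ‖sinhDiv s t‖ ≤ C := by
  obtain ⟨C, hC⟩ := isCompact_Icc.exists_bound_of_continuousOn (s := Icc (-b) b)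
    (contDiff_sinhDiv s (n := 0)).continuous.continuousOn
  exact ⟨max C 0, le_max_right _ _, fun t ht => (hC t ht).trans (le_max_left _ _)⟩

/-- By the mean value inequality the leading term vanishes linearly at the chord ends, with a
constant uniform in `x`. This decay is what later absorbs the derivative of the cutoff. -/
theorem leadingTerm_bounds {b : ℝ} (hb : 0 < b) {s : ℂ} (hs : s ∉ imaginaryCuts b) :
    ∃ C : ℝ, 0 ≤ C ∧ ∀ x y : ℝ, (x, y) ∈ diskDomain b →
      ‖leadingTermY b s (x, y)‖ ≤ C ∧
      ‖leadingTerm b s (x, y)‖ ≤ C * (√(b ^ 2 - x ^ 2) - |y|) := by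
  obtain ⟨M, hM0, hM⟩ := exists_norm_sinhDiv_le s b
  obtain ⟨K, hK⟩ := isCompact_Icc.exists_bound_of_continuousOn (s := Icc 0 b)
    (f := fun t : ℝ => (Complex.cosh (s * t))⁻¹)
    ((contDiff_cosh_mul s (n := 0)).continuous.continuousOn.inv₀ fun t ht =>
      cosh_ne_zero_of_notMem_cuts hs ht.1 ht.2)
  have hK0 : 0 ≤ K := (norm_nonneg _).trans (hK 0 ⟨le_rfl, hb.le⟩)
  refine ⟨M * K, by positivity, fun x y hxy => ?_⟩
  have hyY := mem_diskDomain_iff_abs_lt.1 hxy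
  have hYm := sqrt_sub_sq_mem_Icc hb x
  set Y := √(b ^ 2 - x ^ 2) with hY
  have hKY := hK Y hYm
  constructor
  · unfold leadingTermY
    rw [div_eq_mul_inv, norm_mul, norm_neg]
    have := abs_lt.1 hyY
    exact mul_le_mul (hM y ⟨by linarith [hYm.2], by linarith [hYm.2]⟩) hKY (norm_nonneg _) hM0
  · unfold leadingTerm
    rw [div_eq_mul_inv, norm_mul]
    have hev : coshSubOneDiv s y = coshSubOneDiv s |y| := by
      rcases abs_choice y with h | h <;> rw [h]; rw [coshSubOneDiv_neg]
    have hmv : ‖coshSubOneDiv s Y - coshSubOneDiv s |y|‖ ≤ M * ‖Y - |y|‖ :=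
      (convex_Icc (-b) b).norm_image_sub_le_of_norm_hasDerivWithin_le
        (fun t _ => (hasDerivAt_coshSubOneDiv s t).hasDerivWithinAt) hM
        ⟨by linarith [abs_nonneg y], by linarith [hYm.2]⟩ ⟨by linarith [hYm.1], hYm.2⟩
    rw [Real.norm_of_nonneg (by linarith)] at hmv
    simp only
    rw [hev]
    calc _ ≤ M * (Y - |y|) * K := mul_le_mul hmv hKY (norm_nonneg _)
          (mul_nonneg hM0 (by linarith))
      _ = _ := by ring

/-! ### The average of the leading term -/

theorem integral_cosh_mul_symm (s : ℂ) (t : ℝ) :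
    ∫ y in (-t)..t, Complex.cosh (s * (y : ℂ)) = 2 * sinhDiv s t := by
  rw [intervalIntegral.integral_eq_sub_of_hasDerivAt (fun y _ => hasDerivAt_sinhDiv s y)
    ((contDiff_cosh_mul s (n := 0)).continuous.intervalIntegrable _ _), sinhDiv_neg]
  ring

theorem section_integral_of_ne_zero {s : ℂ} (hs : s ≠ 0) {t : ℝ}
    (ht : Complex.cosh (s * t) ≠ 0) :
    ∫ y in (-t)..t, (coshSubOneDiv s t - coshSubOneDiv s y) / Complex.cosh (s * t)
      = 2 / s ^ 2 * (t - Complex.tanh (s * t) / s) := by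
  have h : ∀ y : ℝ, (coshSubOneDiv s t - coshSubOneDiv s y) / Complex.cosh (s * t)
      = 1 / s ^ 2 - Complex.cosh (s * y) * (1 / (s ^ 2 * Complex.cosh (s * t))) := by
    intro y
    simp only [coshSubOneDiv, hs, if_false]
    field_simp
    ring
  simp_rw [h]
  have hc := (contDiff_cosh_mul s (n := 0)).continuous
  rw [intervalIntegral.integral_sub (by simp)
    ((by fun_prop : Continuous fun y : ℝ => Complex.cosh (s * y) *
      (1 / (s ^ 2 * Complex.cosh (s * t)))).intervalIntegrable _ _),
    intervalIntegral.integral_mul_const, integral_cosh_mul_symm, intervalIntegral.integral_const]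
  simp only [sinhDiv, hs, if_false, Complex.tanh_eq_sinh_div_cosh, Complex.real_smul]
  push_cast
  field_simp
  ring

theorem section_integral_zero (t : ℝ) :
    ∫ y in (-t)..t, (coshSubOneDiv 0 t - coshSubOneDiv 0 y) / Complex.cosh (0 * t)
      = 2 / 3 * (t : ℂ) ^ 3 := by
  have h : ∀ y : ℝ, (coshSubOneDiv 0 t - coshSubOneDiv 0 y) / Complex.cosh (0 * t)
      = ((t ^ 2 / 2 - y ^ 2 / 2 : ℝ) : ℂ) := by
    intro y
    simp [coshSubOneDiv]
  simp_rw [h]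
  rw [intervalIntegral.integral_ofReal, intervalIntegral.integral_sub (by simp)
    ((by fun_prop : Continuous fun y : ℝ => y ^ 2 / 2).intervalIntegrable _ _),
    intervalIntegral.integral_div, intervalIntegral.integral_div, integral_pow,
    intervalIntegral.integral_const]
  simp only [smul_eq_mul]
  push_cast
  ring

theorem integrableOn_leadingTerm {b : ℝ} (hb : 0 < b) {s : ℂ} (hs : s ∉ imaginaryCuts b) :
    IntegrableOn (leadingTerm b s) (diskDomain b) :=
  ((continuous_leadingTerm hb hs).continuousOn.integrableOn_compact isCompact_Icc).mono_set
    (diskDomain_subset_Icc hb)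

/-- The chord integral depends on `x` only through the half-chord `√(b² - x²)`, so the average is
one trigonometric integral. The function `g` is a parameter to treat `s ≠ 0` and `s = 0` alike. -/
theorem average_leadingTerm {b : ℝ} (hb : 0 < b) {s : ℂ} (hs : s ∉ imaginaryCuts b)
    {g : ℝ → ℂ} (hg : ContinuousOn g (Icc 0 b))
    (hsec : ∀ t ∈ Icc 0 b, ∫ y in (-t)..t, (coshSubOneDiv s t - coshSubOneDiv s y) /
      Complex.cosh (s * t) = g t) :
    ⨍ p in diskDomain b, leadingTerm b s p = 1 / (Real.pi * b ^ 2) *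
      ∫ φ in (-(Real.pi / 2))..(Real.pi / 2), g (b * Real.cos φ) * (b * Real.cos φ : ℝ) := by
  have hg0 : g 0 = 0 := by
    rw [← hsec 0 ⟨le_rfl, hb.le⟩]
    simp
  rw [← integral_comp_sqrt_sub_sq hb hg0 hg, setAverage_eq, volume_real_diskDomain hb,
    setIntegral_diskDomain (integrableOn_leadingTerm hb hs), Complex.real_smul]
  congr 1
  · push_cast
    rw [one_div]
  · congr 1
    ext x
    simp only [leadingTerm]
    exact hsec _ (sqrt_sub_sq_mem_Icc hb x)

theorem cosh_ne_zero_of_abs_le {b : ℝ} {s : ℂ} (hs : s ∉ imaginaryCuts b)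
    {t : ℝ} (ht : |t| ≤ b) : Complex.cosh (s * t) ≠ 0 := by
  have h := cosh_ne_zero_of_notMem_cuts hs (abs_nonneg t) ht
  rcases abs_choice t with h' | h' <;> rw [h'] at h
  · exact h
  · simpa using h

theorem abs_mul_cos_le {b : ℝ} (hb : 0 < b) (φ : ℝ) : |b * Real.cos φ| ≤ b := by
  rw [abs_mul, abs_of_pos hb]
  exact mul_le_of_le_one_right hb.le (Real.abs_cos_le_one φ)

theorem continuous_cos_mul_tanh {b : ℝ} (hb : 0 < b) {s : ℂ} (hs : s ∉ imaginaryCuts b) :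
    Continuous fun φ : ℝ => (Real.cos φ : ℂ) *
      Complex.tanh ((b : ℂ) * s * (Real.cos φ : ℂ)) := by
  simp only [Complex.tanh_eq_sinh_div_cosh]
  refine (by fun_prop : Continuous fun φ : ℝ => (Real.cos φ : ℂ)).mul (Continuous.div ?_ ?_ ?_)
  · exact Complex.continuous_sinh.comp (by fun_prop)
  · exact Complex.continuous_cosh.comp (by fun_prop)
  · intro φ
    have := cosh_ne_zero_of_abs_le hs (abs_mul_cos_le hb φ)
    convert this using 2
    push_cast
    ring

theorem integral_two_pi_cos_mul_tanh {b : ℝ} (hb : 0 < b) {s : ℂ} (hs : s ∉ imaginaryCuts b) :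
    ∫ φ in (0 : ℝ)..(2 * Real.pi), (Real.cos φ : ℂ) *
        Complex.tanh ((b : ℂ) * s * (Real.cos φ : ℂ))
      = 2 * ∫ φ in (-(Real.pi / 2))..(Real.pi / 2), (Real.cos φ : ℂ) *
        Complex.tanh ((b : ℂ) * s * (Real.cos φ : ℂ)) := by
  set F : ℝ → ℂ := fun φ => (Real.cos φ : ℂ) *
      Complex.tanh ((b : ℂ) * s * (Real.cos φ : ℂ)) with hF
  -- A shift by `π` changes the sign of both factors, so the full period is twice the half period.
  have hper : Function.Periodic F Real.pi := fun φ => by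
    simp only [hF, Real.cos_add_pi, Complex.ofReal_neg, mul_neg, Complex.tanh_neg, neg_mul,
      neg_neg]
  have hi : ∀ a c : ℝ, IntervalIntegrable F volume a c := fun a c =>
    (continuous_cos_mul_tanh hb hs).intervalIntegrable a c
  rw [← intervalIntegral.integral_add_adjacent_intervals (hi 0 Real.pi) (hi Real.pi _)]
  have h1 := hper.intervalIntegral_add_eq 0 (-(Real.pi / 2))
  have h2 := hper.intervalIntegral_add_eq Real.pi (-(Real.pi / 2))
  rw [show -(Real.pi / 2) + Real.pi = Real.pi / 2 by ring] at h1 h2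
  rw [zero_add] at h1
  rw [show Real.pi + Real.pi = 2 * Real.pi by ring] at h2
  rw [h1, h2, two_mul]

theorem average_leadingTerm_of_ne_zero {b : ℝ} (hb : 0 < b) {s : ℂ} (hs : s ∉ imaginaryCuts b)
    (hs0 : s ≠ 0) :
    ⨍ p in diskDomain b, leadingTerm b s p = 1 / s ^ 2 - 1 / ((Real.pi : ℂ) * (b : ℂ) * s ^ 3) *
      ∫ φ in (0 : ℝ)..(2 * Real.pi),
        (Real.cos φ : ℂ) * Complex.tanh ((b : ℂ) * s * (Real.cos φ : ℂ)) := by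
  rw [average_leadingTerm hb hs (g := fun t => 2 / s ^ 2 * (t - Complex.tanh (s * t) / s)) ?_
    fun t ht => section_integral_of_ne_zero hs0 (cosh_ne_zero_of_notMem_cuts hs ht.1 ht.2)]
  · have hb' : (b : ℂ) ≠ 0 := by exact_mod_cast hb.ne'
    have hpi : (Real.pi : ℂ) ≠ 0 := by exact_mod_cast Real.pi_ne_zero
    have e : ∀ φ : ℝ, 2 / s ^ 2 * (((b * Real.cos φ : ℝ) : ℂ) -
        Complex.tanh (s * ((b * Real.cos φ : ℝ) : ℂ)) / s) * ((b * Real.cos φ : ℝ) : ℂ)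
        = 2 * (b : ℂ) ^ 2 / s ^ 2 * ((Real.cos φ ^ 2 : ℝ) : ℂ) - 2 * b / s ^ 3 *
          ((Real.cos φ : ℂ) * Complex.tanh ((b : ℂ) * s * (Real.cos φ : ℂ))) := by
      intro φ
      rw [show s * ((b * Real.cos φ : ℝ) : ℂ) = (b : ℂ) * s * (Real.cos φ : ℂ) by
        push_cast; ring]
      push_cast
      field_simp
    simp_rw [e]
    have hF : Continuous fun φ : ℝ => 2 * (b : ℂ) / s ^ 3 * ((Real.cos φ : ℂ) *
        Complex.tanh ((b : ℂ) * s * (Real.cos φ : ℂ))) :=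
      continuous_const.mul (continuous_cos_mul_tanh hb hs)
    rw [intervalIntegral.integral_sub
      ((by fun_prop : Continuous fun φ : ℝ => 2 * (b : ℂ) ^ 2 / s ^ 2 *
        ((Real.cos φ ^ 2 : ℝ) : ℂ)).intervalIntegrable _ _)
      (hF.intervalIntegrable _ _),
      intervalIntegral.integral_const_mul, intervalIntegral.integral_const_mul,
      intervalIntegral.integral_ofReal, integral_cos_sq, integral_two_pi_cos_mul_tanh hb hs]
    simp only [Real.cos_neg, Real.cos_pi_div_two, zero_mul]
    push_cast
    field_simp
    ring
  · have hc := contDiff_cosh_mul s (n := 0)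
    simp only [Complex.tanh_eq_sinh_div_cosh]
    have h1 : ContinuousOn (fun t : ℝ => Complex.sinh (s * t) / Complex.cosh (s * t)) (Icc 0 b) :=
      ContinuousOn.div (Complex.continuous_sinh.comp (by fun_prop)).continuousOn
        hc.continuous.continuousOn fun t ht => cosh_ne_zero_of_notMem_cuts hs ht.1 ht.2
    exact continuousOn_const.mul (Complex.continuous_ofReal.continuousOn.sub (h1.div_const s))

theorem average_leadingTerm_zero {b : ℝ} (hb : 0 < b) (hs : (0 : ℂ) ∉ imaginaryCuts b) :
    ⨍ p in diskDomain b, leadingTerm b 0 p = (b : ℂ) ^ 2 / 4 := by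
  rw [average_leadingTerm hb hs (g := fun t => 2 / 3 * (t : ℂ) ^ 3) (by fun_prop)
    fun t _ => section_integral_zero t]
  have : ∀ φ : ℝ, 2 / 3 * ((b * Real.cos φ : ℝ) : ℂ) ^ 3 * ((b * Real.cos φ : ℝ) : ℂ)
      = ((2 / 3 * b ^ 4 * Real.cos φ ^ 4 : ℝ) : ℂ) := by
    intro φ; push_cast; ring
  simp_rw [this]
  rw [intervalIntegral.integral_ofReal, intervalIntegral.integral_const_mul, integral_cos_pow,
    integral_cos_sq]
  simp
  field_simp
  ring

/-! ### Wallis integrals and the expansion in powers of `s` -/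

theorem integral_cos_pow_even (k : ℕ) :
    ∫ φ in (-(Real.pi / 2))..(Real.pi / 2), Real.cos φ ^ (2 * k)
      = Real.pi * ((2 * k).factorial / (4 ^ k * (k.factorial : ℝ) ^ 2)) := by
  have h := intervalIntegral.integral_comp_sub_right
    (fun φ => Real.cos φ ^ (2 * k)) (Real.pi / 2) (a := 0) (b := Real.pi)
  simp only [Real.cos_sub_pi_div_two, zero_sub] at h
  rw [show Real.pi - Real.pi / 2 = Real.pi / 2 by ring] at h
  rw [← h, integral_sin_pow_even]
  congr 1
  induction k with
  | zero => simp
  | succ k ih =>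
    rw [Finset.prod_range_succ, ih ?_]
    · rw [show 2 * (k + 1) = 2 * k + 1 + 1 by ring, Nat.factorial_succ, Nat.factorial_succ,
        Nat.factorial_succ]
      push_cast
      field_simp
      ring
    -- Since `h` mentions `k`, the induction hypothesis takes it as a premise; the shift identity is
    -- supplied again for exponent `2k`.
    · have h := intervalIntegral.integral_comp_sub_right
        (fun φ => Real.cos φ ^ (2 * k)) (Real.pi / 2) (a := 0) (b := Real.pi)
      simp only [Real.cos_sub_pi_div_two, zero_sub] at h
      rw [show Real.pi - Real.pi / 2 = Real.pi / 2 by ring] at h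
      exact h

/-- As `|cos φ| ≤ 1`, the series at `z cos φ` is dominated by the one at `z` and may be integrated
termwise. The Wallis factor cancels `4^k/(2k)!` and leaves `1/(k!)²`. -/
theorem hasSum_integral_cos_mul_tanh {z : ℂ} (hz : ‖z‖ < Real.pi / 2) :
    HasSum (fun k : ℕ => (Real.pi : ℂ) * (((4 : ℂ) ^ k - 1) * ((bernoulli (2 * k) : ℚ) : ℂ)
        / (k.factorial : ℂ) ^ 2 * z ^ (2 * k)))
      (∫ φ in (-(Real.pi / 2))..(Real.pi / 2), z * ((Real.cos φ : ℂ) *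
        Complex.tanh (z * (Real.cos φ : ℂ)))) := by
  have hsum := (hasSum_mul_tanh hz).summable.norm
  have hnorm : ∀ φ : ℝ, ‖z * (Real.cos φ : ℂ)‖ ≤ ‖z‖ := fun φ => by
    rw [norm_mul, Complex.norm_real]
    exact mul_le_of_le_one_right (norm_nonneg _) (Real.abs_cos_le_one φ)
  have h := intervalIntegral.hasSum_integral_of_dominated_convergence
    (μ := volume) (a := -(Real.pi / 2)) (b := Real.pi / 2)
    (F := fun (k : ℕ) (φ : ℝ) => ((4 : ℂ) ^ k * (4 ^ k - 1)) *
      (((bernoulli (2 * k) : ℚ) : ℂ) / ((2 * k).factorial : ℂ)) *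
        (z * (Real.cos φ : ℂ)) ^ (2 * k))
    (f := fun φ => z * ((Real.cos φ : ℂ) * Complex.tanh (z * (Real.cos φ : ℂ))))
    (fun k _ => ‖((4 : ℂ) ^ k * (4 ^ k - 1)) *
      (((bernoulli (2 * k) : ℚ) : ℂ) / ((2 * k).factorial : ℂ)) * z ^ (2 * k)‖)
    (fun k => (by fun_prop : Continuous _).aestronglyMeasurable)
    (fun k => Eventually.of_forall fun φ _ => by
      rw [norm_mul, norm_mul _ (z ^ (2 * k)), norm_pow, norm_pow]
      gcongr
      exact hnorm φ)
    (Eventually.of_forall fun φ _ => hsum) (by simp)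
    (Eventually.of_forall fun φ _ => by
      rw [← mul_assoc]
      exact hasSum_mul_tanh ((hnorm φ).trans_lt hz))
  refine h.congr_fun fun k => ?_
  have e : ∀ φ : ℝ, ((4 : ℂ) ^ k * (4 ^ k - 1)) *
      (((bernoulli (2 * k) : ℚ) : ℂ) / ((2 * k).factorial : ℂ)) *
        (z * (Real.cos φ : ℂ)) ^ (2 * k) = ((4 : ℂ) ^ k * (4 ^ k - 1)) *
      (((bernoulli (2 * k) : ℚ) : ℂ) / ((2 * k).factorial : ℂ)) * z ^ (2 * k) *
        ((Real.cos φ ^ (2 * k) : ℝ) : ℂ) := by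
    intro φ; push_cast; ring
  simp_rw [e]
  rw [intervalIntegral.integral_const_mul, intervalIntegral.integral_ofReal,
    integral_cos_pow_even]
  push_cast
  have : ((2 * k).factorial : ℂ) ≠ 0 := by exact_mod_cast (Nat.factorial_pos _).ne'
  have : (k.factorial : ℂ) ≠ 0 := by exact_mod_cast (Nat.factorial_pos _).ne'
  field_simp

theorem hasSum_smallTerm {b : ℝ} (hb : 0 < b) {s : ℂ} (hs : s ∉ imaginaryCuts b)
    (hlt : ‖s‖ < Real.pi / (2 * b)) :
    HasSum (fun j : ℕ => smallTerm b s (j + 2)) (⨍ p in diskDomain b, leadingTerm b s p) := by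
  have hb' : (b : ℂ) ≠ 0 := by exact_mod_cast hb.ne'
  have hb4 : bernoulli 4 = -1 / 30 := by
    rw [bernoulli_eq_bernoulli'_of_ne_one (by norm_num), bernoulli'_four]
  rcases eq_or_ne s 0 with rfl | hs0
  · rw [average_leadingTerm_zero hb hs]
    have h0 : smallTerm b 0 (0 + 2) = (b : ℂ) ^ 2 / 4 := by
      simp only [smallTerm, zero_add]
      norm_num [hb4, Nat.factorial]
      ring
    rw [← h0]
    refine hasSum_single 0 fun j hj => ?_
    simp only [smallTerm, mul_zero]
    rw [zero_pow (by omega)]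
    simp
  · have hpi : (Real.pi : ℂ) ≠ 0 := by exact_mod_cast Real.pi_ne_zero
    have hz : ‖(b : ℂ) * s‖ < Real.pi / 2 := by
      rw [norm_mul, Complex.norm_real, Real.norm_of_nonneg hb.le]
      rw [lt_div_iff₀ (by positivity)] at hlt
      linarith
    have h := hasSum_integral_cos_mul_tanh hz
    rw [intervalIntegral.integral_const_mul] at h
    rw [average_leadingTerm_of_ne_zero hb hs hs0, integral_two_pi_cos_mul_tanh hb hs]
    generalize (∫ φ in (-(Real.pi / 2))..(Real.pi / 2), (Real.cos φ : ℂ) *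
        Complex.tanh ((b : ℂ) * s * (Real.cos φ : ℂ))) = I at h ⊢
    rw [← hasSum_nat_add_iff' 2] at h
    have h2 := h.mul_left (-2 / (Real.pi * (b : ℂ) ^ 2 * s ^ 4))
    have e1 : ∀ j : ℕ, smallTerm b s (j + 2) = -2 / (Real.pi * (b : ℂ) ^ 2 * s ^ 4) *
        ((Real.pi : ℂ) * (((4 : ℂ) ^ (j + 2) - 1) * ((bernoulli (2 * (j + 2)) : ℚ) : ℂ)
        / ((j + 2).factorial : ℂ) ^ 2 * ((b : ℂ) * s) ^ (2 * (j + 2)))) := by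
      intro j
      have e4 : (2 : ℂ) ^ (2 * (j + 2)) = 4 ^ (j + 2) := by rw [pow_mul]; norm_num
      simp only [smallTerm, e4]
      rw [show 2 * (j + 2) - 4 = 2 * j by omega, show 2 * (j + 2) = 2 * j + 4 by ring,
        pow_add ((b : ℂ) * s), mul_pow (b : ℂ) s 4]
      field_simp
    -- The term `k = 0` is zero, and `k = 1`, with `B₂ = 1/6`, is exactly what the summand `1/s²`
    -- removes; hence the series starts at `k = 2`.
    have e2 : 1 / s ^ 2 - 1 / ((Real.pi : ℂ) * b * s ^ 3) * (2 * I)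
        = -2 / (Real.pi * (b : ℂ) ^ 2 * s ^ 4) * ((b : ℂ) * s * I -
        ∑ i ∈ Finset.range 2, (Real.pi : ℂ) * (((4 : ℂ) ^ i - 1) * ((bernoulli (2 * i) : ℚ) : ℂ)
        / (i.factorial : ℂ) ^ 2 * ((b : ℂ) * s) ^ (2 * i))) := by
      simp [Finset.sum_range_succ, bernoulli_two]
      field_simp
      ring
    rw [e2]
    exact h2.congr_fun e1

/-! ### The sharp Poincaré inequality in a strip -/

/-- Completing the square: `g'² - μ²g² + (μ tan(μt) g²)' = (g' + μ tan(μt) g)²`. The total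
derivative integrates to zero because `g` vanishes at `±b`, and `μb < π/2` keeps the tangent finite
on the interval. -/
theorem poincare_interval_real {b μ : ℝ} (hb : 0 < b) (hμ : 0 < μ) (hμb : μ * b < Real.pi / 2)
    {g g' : ℝ → ℝ} (hg : ∀ t, HasDerivAt g (g' t) t) (hg' : Continuous g')
    (h1 : g b = 0) (h2 : g (-b) = 0) :
    μ ^ 2 * ∫ t in (-b)..b, g t ^ 2 ≤ ∫ t in (-b)..b, g' t ^ 2 := by
  have hgc : Continuous g := continuous_iff_continuousAt.2 fun t => (hg t).continuousAt
  have hle : -b ≤ b := by linarith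
  have hcos : ∀ t ∈ Icc (-b) b, Real.cos (μ * t) ≠ 0 := fun t ht =>
    (Real.cos_pos_of_mem_Ioo ⟨by nlinarith [ht.1], by nlinarith [ht.2]⟩).ne'
  have htan : ∀ t ∈ Icc (-b) b,
      HasDerivAt (fun t => Real.tan (μ * t)) (μ * (1 + Real.tan (μ * t) ^ 2)) t := by
    intro t ht
    have h0 : HasDerivAt (fun t : ℝ => μ * t) μ t := by
      simpa using (hasDerivAt_id t).const_mul μ
    refine ((Real.hasDerivAt_tan (hcos t ht)).comp t h0).congr_deriv ?_
    rw [Real.tan_eq_sin_div_cos]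
    have := hcos t ht
    field_simp
    rw [Real.cos_sq_add_sin_sq]
  have htanc : ContinuousOn (fun t => Real.tan (μ * t)) (Icc (-b) b) := fun t ht =>
    (htan t ht).continuousAt.continuousWithinAt
  set G' : ℝ → ℝ := fun t => μ ^ 2 * (1 + Real.tan (μ * t) ^ 2) * g t ^ 2 +
    2 * μ * Real.tan (μ * t) * g t * g' t with hG'
  have hG'c : ContinuousOn G' (Icc (-b) b) := by
    have := hgc.continuousOn (s := Icc (-b) b)
    have := hg'.continuousOn (s := Icc (-b) b)
    fun_prop
  have hGi : IntervalIntegrable G' volume (-b) b := by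
    rw [← uIcc_of_le hle] at hG'c
    exact hG'c.intervalIntegrable
  have hFTC : ∫ t in (-b)..b, G' t = 0 := by
    rw [intervalIntegral.integral_eq_sub_of_hasDerivAt
      (f := fun t => μ * (Real.tan (μ * t) * g t ^ 2)) _ hGi]
    · simp [h1, h2]
    · intro t ht
      rw [uIcc_of_le hle] at ht
      refine (((htan t ht).mul ((hg t).pow 2)).const_mul μ).congr_deriv ?_
      simp only [hG', Pi.pow_apply]
      push_cast
      ring
  have i1 : IntervalIntegrable (fun t => g' t ^ 2) volume (-b) b :=
    (hg'.pow 2).intervalIntegrable _ _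
  have i2 : IntervalIntegrable (fun t => μ ^ 2 * g t ^ 2) volume (-b) b :=
    (continuous_const.mul (hgc.pow 2)).intervalIntegrable _ _
  have hpos : 0 ≤ ∫ t in (-b)..b, (g' t ^ 2 - μ ^ 2 * g t ^ 2 + G' t) :=
    intervalIntegral.integral_nonneg hle fun t _ => by
      have : g' t ^ 2 - μ ^ 2 * g t ^ 2 + G' t = (g' t + μ * Real.tan (μ * t) * g t) ^ 2 := by
        simp only [hG']; ring
      rw [this]; positivity
  rw [intervalIntegral.integral_add (i1.sub i2) hGi, hFTC, intervalIntegral.integral_sub i1 i2,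
    intervalIntegral.integral_const_mul] at hpos
  linarith

theorem poincare_interval {b μ : ℝ} (hb : 0 < b) (hμ : 0 < μ) (hμb : μ * b < Real.pi / 2)
    {f f' : ℝ → ℂ} (hf : ∀ t, HasDerivAt f (f' t) t) (hf' : Continuous f')
    (h1 : f b = 0) (h2 : f (-b) = 0) :
    μ ^ 2 * ∫ t in (-b)..b, ‖f t‖ ^ 2 ≤ ∫ t in (-b)..b, ‖f' t‖ ^ 2 := by
  have hfc : Continuous f := continuous_iff_continuousAt.2 fun t => (hf t).continuousAt
  have hre := poincare_interval_real hb hμ hμb (g := fun t => (f t).re) (g' := fun t => (f' t).re)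
    (fun t => Complex.reCLM.hasFDerivAt.comp_hasDerivAt t (hf t))
    (Complex.continuous_re.comp hf') (by simp [h1]) (by simp [h2])
  have him := poincare_interval_real hb hμ hμb (g := fun t => (f t).im) (g' := fun t => (f' t).im)
    (fun t => Complex.imCLM.hasFDerivAt.comp_hasDerivAt t (hf t))
    (Complex.continuous_im.comp hf') (by simp [h1]) (by simp [h2])
  have hsplit : ∀ h : ℝ → ℂ, Continuous h → ∫ t in (-b)..b, ‖h t‖ ^ 2
      = (∫ t in (-b)..b, (h t).re ^ 2) + ∫ t in (-b)..b, (h t).im ^ 2 := by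
    intro h hh
    rw [← intervalIntegral.integral_add
      ((by fun_prop : Continuous fun t => (h t).re ^ 2).intervalIntegrable _ _)
      ((by fun_prop : Continuous fun t => (h t).im ^ 2).intervalIntegrable _ _)]
    congr 1
    ext t
    rw [Complex.sq_norm, Complex.normSq_apply]
    ring
  rw [hsplit f hfc, hsplit f' hf']
  linarith

/-! ### Test functions -/

theorem IsTestFunction.continuous_partialX {Ω : Set (ℝ × ℝ)} {φ : ℝ × ℝ → ℂ}
    (h : IsTestFunction Ω φ) : Continuous (partialX φ) :=
  (h.smooth.continuous_fderiv (by simp)).clm_apply continuous_const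

theorem IsTestFunction.continuous_partialY {Ω : Set (ℝ × ℝ)} {φ : ℝ × ℝ → ℂ}
    (h : IsTestFunction Ω φ) : Continuous (partialY φ) :=
  (h.smooth.continuous_fderiv (by simp)).clm_apply continuous_const

theorem IsTestFunction.hasCompactSupport_partialX {Ω : Set (ℝ × ℝ)} {φ : ℝ × ℝ → ℂ}
    (h : IsTestFunction Ω φ) : HasCompactSupport (partialX φ) :=
  h.compact.fderiv_apply ℝ (1, 0)

theorem IsTestFunction.hasCompactSupport_partialY {Ω : Set (ℝ × ℝ)} {φ : ℝ × ℝ → ℂ}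
    (h : IsTestFunction Ω φ) : HasCompactSupport (partialY φ) :=
  h.compact.fderiv_apply ℝ (0, 1)

theorem IsTestFunction.eq_zero {Ω : Set (ℝ × ℝ)} {φ : ℝ × ℝ → ℂ}
    (h : IsTestFunction Ω φ) {p : ℝ × ℝ} (hp : p ∉ Ω) : φ p = 0 :=
  image_eq_zero_of_notMem_tsupport fun h' => hp (h.support h')

theorem IsTestFunction.partialY_eq_zero {Ω : Set (ℝ × ℝ)} {φ : ℝ × ℝ → ℂ}
    (h : IsTestFunction Ω φ) {p : ℝ × ℝ} (hp : p ∉ Ω) : partialY φ p = 0 :=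
  image_eq_zero_of_notMem_tsupport fun h' =>
    hp (h.support (tsupport_fderiv_apply_subset ℝ (0, 1) h'))

theorem IsTestFunction.memLp {Ω : Set (ℝ × ℝ)} {φ : ℝ × ℝ → ℂ}
    (h : IsTestFunction Ω φ) (ν : Measure (ℝ × ℝ)) [IsFiniteMeasureOnCompacts ν] : MemLp φ 2 ν :=
  h.smooth.continuous.memLp_of_hasCompactSupport h.compact

theorem IsTestFunction.memLp_partialX {Ω : Set (ℝ × ℝ)} {φ : ℝ × ℝ → ℂ}
    (h : IsTestFunction Ω φ) (ν : Measure (ℝ × ℝ)) [IsFiniteMeasureOnCompacts ν] :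
    MemLp (partialX φ) 2 ν :=
  h.continuous_partialX.memLp_of_hasCompactSupport h.hasCompactSupport_partialX

theorem IsTestFunction.memLp_partialY {Ω : Set (ℝ × ℝ)} {φ : ℝ × ℝ → ℂ}
    (h : IsTestFunction Ω φ) (ν : Measure (ℝ × ℝ)) [IsFiniteMeasureOnCompacts ν] :
    MemLp (partialY φ) 2 ν :=
  h.continuous_partialY.memLp_of_hasCompactSupport h.hasCompactSupport_partialY

theorem IsTestFunction.hasDerivAt_section {Ω : Set (ℝ × ℝ)} {φ : ℝ × ℝ → ℂ}
    (h : IsTestFunction Ω φ) (x y : ℝ) :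
    HasDerivAt (fun t => φ (x, t)) (partialY φ (x, y)) y := by
  have h1 := (h.smooth.differentiable (by simp) (x, y)).hasFDerivAt
  have h2 : HasDerivAt (fun t : ℝ => (x, t)) ((0 : ℝ), (1 : ℝ)) y :=
    (hasDerivAt_const y x).prodMk (hasDerivAt_id y)
  exact h1.comp_hasDerivAt y h2

theorem differentiable_of_smooth {φ : ℝ × ℝ → ℂ} (h : ContDiff ℝ (⊤ : ℕ∞) φ) :
    Differentiable ℝ φ := h.differentiable (by simp)

theorem IsTestFunction.add {Ω : Set (ℝ × ℝ)} {φ ψ : ℝ × ℝ → ℂ}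
    (h : IsTestFunction Ω φ) (h' : IsTestFunction Ω ψ) : IsTestFunction Ω (φ + ψ) where
  smooth := h.smooth.add h'.smooth
  compact := h.compact.add h'.compact
  support := (tsupport_add φ ψ).trans (union_subset h.support h'.support)

theorem IsTestFunction.comp_clm {Ω : Set (ℝ × ℝ)} {φ : ℝ × ℝ → ℂ}
    (h : IsTestFunction Ω φ) (L : ℂ →L[ℝ] ℂ) : IsTestFunction Ω (L ∘ φ) where
  smooth := L.contDiff.comp h.smooth
  compact := h.compact.comp_left L.map_zero
  support := (closure_mono (Function.support_comp_subset L.map_zero φ)).trans h.support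

theorem partialX_comp_clm {φ : ℝ × ℝ → ℂ} (h : Differentiable ℝ φ) (L : ℂ →L[ℝ] ℂ)
    (p : ℝ × ℝ) : partialX (L ∘ φ) p = L (partialX φ p) := by
  simp only [partialX]
  rw [(L.hasFDerivAt.comp p (h p).hasFDerivAt).fderiv]
  rfl

theorem partialY_comp_clm {φ : ℝ × ℝ → ℂ} (h : Differentiable ℝ φ) (L : ℂ →L[ℝ] ℂ)
    (p : ℝ × ℝ) : partialY (L ∘ φ) p = L (partialY φ p) := by
  simp only [partialY]
  rw [(L.hasFDerivAt.comp p (h p).hasFDerivAt).fderiv]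
  rfl

theorem partialX_add {φ ψ : ℝ × ℝ → ℂ} (h : Differentiable ℝ φ) (h' : Differentiable ℝ ψ) :
    partialX (φ + ψ) = partialX φ + partialX ψ := by
  ext p; simp only [partialX, Pi.add_apply]; rw [fderiv_add (h p) (h' p)]; rfl

theorem partialY_add {φ ψ : ℝ × ℝ → ℂ} (h : Differentiable ℝ φ) (h' : Differentiable ℝ ψ) :
    partialY (φ + ψ) = partialY φ + partialY ψ := by
  ext p; simp only [partialY, Pi.add_apply]; rw [fderiv_add (h p) (h' p)]; rfl

theorem poincare_strip {Ω : Set (ℝ × ℝ)} {b μ : ℝ} (hb : 0 < b)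
    (hΩ : ∀ p ∈ Ω, |p.2| < b) (hμ : 0 < μ) (hμb : μ * b < Real.pi / 2) {φ : ℝ × ℝ → ℂ}
    (h : IsTestFunction Ω φ) :
    μ ^ 2 * ∫ p in Ω, ‖φ p‖ ^ 2 ≤ ∫ p in Ω, ‖partialY φ p‖ ^ 2 := by
  have e1 : ∫ p in Ω, ‖φ p‖ ^ 2 = ∫ p, ‖φ p‖ ^ 2 :=
    setIntegral_eq_integral_of_forall_compl_eq_zero fun p hp => by simp [h.eq_zero hp]
  have e2 : ∫ p in Ω, ‖partialY φ p‖ ^ 2 = ∫ p, ‖partialY φ p‖ ^ 2 :=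
    setIntegral_eq_integral_of_forall_compl_eq_zero fun p hp => by simp [h.partialY_eq_zero hp]
  have i1 : Integrable (fun p => ‖φ p‖ ^ 2) (volume : Measure (ℝ × ℝ)) :=
    (h.memLp volume).integrable_norm_pow (by norm_num)
  have i2 : Integrable (fun p => ‖partialY φ p‖ ^ 2) (volume : Measure (ℝ × ℝ)) :=
    (h.memLp_partialY volume).integrable_norm_pow (by norm_num)
  rw [e1, e2]
  rw [Measure.volume_eq_prod] at i1 i2 ⊢
  rw [integral_prod _ i1, integral_prod _ i2, ← integral_const_mul]
  refine integral_mono (i1.integral_prod_left.const_mul _) i2.integral_prod_left fun x => ?_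
  have hout : ∀ t, t ∉ Ioc (-b) b → (x, t) ∉ Ω := fun t ht hm => by
    have := abs_lt.1 (hΩ _ hm)
    exact ht ⟨this.1, this.2.le⟩
  have hbd : ∀ t, |t| = b → φ (x, t) = 0 := fun t ht => h.eq_zero fun hm =>
    (hΩ _ hm).ne ht
  have hsec : ∀ f : ℝ → ℝ, (∀ t, (x, t) ∉ Ω → f t = 0) → ∫ t, f t = ∫ t in (-b)..b, f t := by
    intro f hf
    rw [intervalIntegral.integral_of_le (by linarith),
      setIntegral_eq_integral_of_forall_compl_eq_zero fun t ht => hf t (hout t ht)]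
  simp only
  rw [hsec (fun t => ‖φ (x, t)‖ ^ 2) fun t ht => by simp [h.eq_zero ht],
    hsec (fun t => ‖partialY φ (x, t)‖ ^ 2) fun t ht => by simp [h.partialY_eq_zero ht]]
  exact poincare_interval hb hμ hμb (h.hasDerivAt_section x)
    (h.continuous_partialY.comp (by fun_prop)) (hbd b (abs_of_pos hb))
    (hbd (-b) (by rw [abs_neg, abs_of_pos hb]))

/-! ### The Lax–Milgram theorem for complex forms -/

/-- Coercivity bounds `A` from below, so its range is closed, and a vector orthogonal to the range
must vanish. The factor `ω` is needed because the form itself may have negative real part. -/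
theorem exists_eq_of_coercive {H : Type*} [NormedAddCommGroup H] [InnerProductSpace ℂ H]
    [CompleteSpace H] (A : H →L[ℂ] H) {c : ℝ} (hc : 0 < c) {ω : ℂ} (hω : ‖ω‖ ≤ 1)
    (hA : ∀ v, c * ‖v‖ ^ 2 ≤ (ω * inner ℂ v (A v)).re) (e : H) : ∃ w, A w = e := by
  have hbound : ∀ v, ‖v‖ ≤ c⁻¹ * ‖A v‖ := by
    intro v
    rcases (norm_nonneg v).eq_or_lt with h0 | h0
    · rw [← h0]; positivity
    have h1 : (ω * inner ℂ v (A v)).re ≤ ‖v‖ * ‖A v‖ :=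
      calc (ω * inner ℂ v (A v)).re ≤ ‖ω * inner ℂ v (A v)‖ := Complex.re_le_norm _
        _ ≤ 1 * (‖v‖ * ‖A v‖) := by
          rw [norm_mul]
          exact mul_le_mul hω (norm_inner_le_norm _ _) (norm_nonneg _) zero_le_one
        _ = _ := one_mul _
    have h2 := (hA v).trans h1
    rw [inv_mul_eq_div, le_div_iff₀ hc]
    nlinarith
  have hanti : AntilipschitzWith (c⁻¹).toNNReal A := by
    refine A.antilipschitz_of_bound fun v => ?_
    rw [Real.coe_toNNReal _ (by positivity)]
    exact hbound v
  have hclosed : IsClosed (A.range : Set H) := hanti.isClosed_range A.uniformContinuous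
  have := hclosed.completeSpace_coe
  have htop : A.range = ⊤ := by
    rw [← A.range.orthogonal_orthogonal, Submodule.eq_top_iff']
    intro v w hw
    have h0 : inner ℂ w (A w) = 0 := by
      rw [← inner_conj_symm, show inner ℂ (A w) w = 0 from hw _ ⟨w, rfl⟩, map_zero]
    have h1 := hA w
    rw [h0, mul_zero, Complex.zero_re] at h1
    have : w = 0 := by
      by_contra hne
      have : 0 < c * ‖w‖ ^ 2 := by positivity
      linarith
    rw [this, inner_zero_left]
  have : e ∈ A.range := htop ▸ Submodule.mem_top
  exact this

/-- The preceding result applied to the compression of `A` to `V` by the orthogonal projection. -/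
theorem exists_eq_of_coercive_on {H : Type*} [NormedAddCommGroup H] [InnerProductSpace ℂ H]
    [CompleteSpace H] (V : Submodule ℂ H) (hV : IsClosed (V : Set H)) (A : H →L[ℂ] H) {c : ℝ}
    (hc : 0 < c) {ω : ℂ} (hω : ‖ω‖ ≤ 1)
    (hA : ∀ v ∈ V, c * ‖v‖ ^ 2 ≤ (ω * inner ℂ v (A v)).re) (e : H) :
    ∃ w ∈ V, ∀ v ∈ V, inner ℂ v (A w) = inner ℂ v e := by
  have := hV.completeSpace_coe
  have hP : ∀ (v : V) (x : H), inner ℂ v (V.orthogonalProjectionOnto x) = inner ℂ (v : H) x :=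
    fun v x => Submodule.inner_orthogonalProjectionOnto_eq_of_mem_left v x
  obtain ⟨w, hw⟩ := exists_eq_of_coercive (V.orthogonalProjectionOnto ∘L A ∘L V.subtypeL) hc hω
    (fun v => by
      have := hA v v.2
      rw [← hP] at this
      exact this)
    (V.orthogonalProjectionOnto e)
  refine ⟨w, w.2, fun v hv => ?_⟩
  have h := congrArg (fun z : V => inner ℂ (⟨v, hv⟩ : V) z) hw
  simp only [hP] at h
  rw [← h]
  exact (hP ⟨v, hv⟩ _).symm

/-! ### The Sobolev space as a closed subspace of `L² × L² × L²` -/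

/-- Triples of square integrable functions on `Ω`, standing for a function and its gradient. -/
abbrev TripleL2 (Ω : Set (ℝ × ℝ)) : Type :=
  PiLp 2 (fun _ : Fin 3 => Lp ℂ 2 (volume.restrict Ω : Measure (ℝ × ℝ)))

/-- The triple of classes of three square integrable functions. -/
noncomputable def mkTriple {Ω : Set (ℝ × ℝ)} {f g h : ℝ × ℝ → ℂ}
    (hf : MemLp f 2 (volume.restrict Ω)) (hg : MemLp g 2 (volume.restrict Ω))
    (hh : MemLp h 2 (volume.restrict Ω)) : TripleL2 Ω :=
  WithLp.toLp 2 ![hf.toLp f, hg.toLp g, hh.toLp h]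

/-- The triple of a test function and its gradient. -/
noncomputable def IsTestFunction.triple {Ω : Set (ℝ × ℝ)} {φ : ℝ × ℝ → ℂ}
    (h : IsTestFunction Ω φ) : TripleL2 Ω :=
  mkTriple (h.memLp _) (h.memLp_partialX _) (h.memLp_partialY _)

theorem mkTriple_congr {Ω : Set (ℝ × ℝ)} {f g h f' g' h' : ℝ × ℝ → ℂ}
    {hf : MemLp f 2 (volume.restrict Ω)} {hg : MemLp g 2 (volume.restrict Ω)}
    {hh : MemLp h 2 (volume.restrict Ω)} {hf' : MemLp f' 2 (volume.restrict Ω)}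
    {hg' : MemLp g' 2 (volume.restrict Ω)} {hh' : MemLp h' 2 (volume.restrict Ω)}
    (e1 : f =ᵐ[volume.restrict Ω] f') (e2 : g =ᵐ[volume.restrict Ω] g')
    (e3 : h =ᵐ[volume.restrict Ω] h') : mkTriple hf hg hh = mkTriple hf' hg' hh' := by
  simp only [mkTriple, MemLp.toLp_congr hf hf' e1, MemLp.toLp_congr hg hg' e2,
    MemLp.toLp_congr hh hh' e3]

theorem mkTriple_add {Ω : Set (ℝ × ℝ)} {f g h f' g' h' : ℝ × ℝ → ℂ}
    (hf : MemLp f 2 (volume.restrict Ω)) (hg : MemLp g 2 (volume.restrict Ω))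
    (hh : MemLp h 2 (volume.restrict Ω)) (hf' : MemLp f' 2 (volume.restrict Ω))
    (hg' : MemLp g' 2 (volume.restrict Ω)) (hh' : MemLp h' 2 (volume.restrict Ω)) :
    mkTriple hf hg hh + mkTriple hf' hg' hh'
      = mkTriple (hf.add hf') (hg.add hg') (hh.add hh') := by
  simp only [mkTriple]
  rw [← WithLp.toLp_add]
  simp only [Matrix.cons_add_cons, Matrix.empty_add_empty, MemLp.toLp_add hf hf',
    MemLp.toLp_add hg hg', MemLp.toLp_add hh hh']

theorem mkTriple_smul {Ω : Set (ℝ × ℝ)} (c : ℂ) {f g h : ℝ × ℝ → ℂ}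
    (hf : MemLp f 2 (volume.restrict Ω)) (hg : MemLp g 2 (volume.restrict Ω))
    (hh : MemLp h 2 (volume.restrict Ω)) :
    c • mkTriple hf hg hh
      = mkTriple (hf.const_smul c) (hg.const_smul c) (hh.const_smul c) := by
  simp only [mkTriple]
  rw [← WithLp.toLp_smul]
  simp only [Matrix.smul_cons, Matrix.smul_empty, MemLp.toLp_const_smul c hf,
    MemLp.toLp_const_smul c hg, MemLp.toLp_const_smul c hh]

theorem IsTestFunction.zero (Ω : Set (ℝ × ℝ)) : IsTestFunction Ω 0 :=
  ⟨contDiff_const, HasCompactSupport.zero, by simp [tsupport]⟩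

theorem IsTestFunction.triple_add {Ω : Set (ℝ × ℝ)} {φ ψ : ℝ × ℝ → ℂ}
    (h : IsTestFunction Ω φ) (h' : IsTestFunction Ω ψ) :
    h.triple + h'.triple = (h.add h').triple := by
  have hd := differentiable_of_smooth h.smooth
  have hd' := differentiable_of_smooth h'.smooth
  refine (mkTriple_add _ _ _ _ _ _).trans (mkTriple_congr EventuallyEq.rfl ?_ ?_)
  · rw [partialX_add hd hd']
  · rw [partialY_add hd hd']

theorem IsTestFunction.exists_triple_smul {Ω : Set (ℝ × ℝ)} {φ : ℝ × ℝ → ℂ}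
    (h : IsTestFunction Ω φ) (c : ℂ) :
    ∃ (ψ : ℝ × ℝ → ℂ) (h' : IsTestFunction Ω ψ), c • h.triple = h'.triple := by
  set L : ℂ →L[ℝ] ℂ := (c • ContinuousLinearMap.id ℂ ℂ).restrictScalars ℝ with hL
  have hd := differentiable_of_smooth h.smooth
  refine ⟨L ∘ φ, h.comp_clm L, (mkTriple_smul c _ _ _).trans
    (mkTriple_congr EventuallyEq.rfl ?_ ?_)⟩
  · exact Eventually.of_forall fun p => (partialX_comp_clm hd L p).symm
  · exact Eventually.of_forall fun p => (partialY_comp_clm hd L p).symm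

/-- The triples of test functions. -/
noncomputable def testTriples (Ω : Set (ℝ × ℝ)) : Submodule ℂ (TripleL2 Ω) where
  carrier := {w | ∃ (φ : ℝ × ℝ → ℂ) (h : IsTestFunction Ω φ), w = h.triple}
  add_mem' := by
    rintro _ _ ⟨φ, h, rfl⟩ ⟨ψ, h', rfl⟩
    exact ⟨φ + ψ, h.add h', h.triple_add h'⟩
  zero_mem' := by
    obtain ⟨ψ, h', e⟩ := (IsTestFunction.zero Ω).exists_triple_smul 0
    exact ⟨ψ, h', by rw [← e, zero_smul]⟩
  smul_mem' := by
    rintro c _ ⟨φ, h, rfl⟩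
    exact h.exists_triple_smul c

/-- The Sobolev space `H¹₀(Ω)`, each function taken together with its gradient. -/
noncomputable def sobolevTriples (Ω : Set (ℝ × ℝ)) : Submodule ℂ (TripleL2 Ω) :=
  (testTriples Ω).topologicalClosure

theorem IsTestFunction.triple_mem {Ω : Set (ℝ × ℝ)} {φ : ℝ × ℝ → ℂ}
    (h : IsTestFunction Ω φ) : h.triple ∈ sobolevTriples Ω :=
  Submodule.le_topologicalClosure _ ⟨φ, h, rfl⟩

theorem isClosed_sobolevTriples (Ω : Set (ℝ × ℝ)) :
    IsClosed (sobolevTriples Ω : Set (TripleL2 Ω)) :=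
  Submodule.isClosed_topologicalClosure _

/-- The density argument in reusable form: the Poincaré inequality and the weak equations are closed
conditions, so test functions suffice. -/
theorem sobolevTriples_induction {Ω : Set (ℝ × ℝ)} {P : TripleL2 Ω → Prop}
    (hP : IsClosed {w | P w})
    (htest : ∀ (φ : ℝ × ℝ → ℂ) (h : IsTestFunction Ω φ), P h.triple) :
    ∀ w ∈ sobolevTriples Ω, P w := by
  intro w hw
  have : closure (testTriples Ω : Set (TripleL2 Ω)) ⊆ {w | P w} := by
    refine closure_minimal ?_ hP
    rintro _ ⟨φ, h, rfl⟩
    exact htest φ h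
  exact this hw

theorem tendsto_mkTriple_iff {Ω : Set (ℝ × ℝ)} {f g h : ℝ × ℝ → ℂ}
    (hf : MemLp f 2 (volume.restrict Ω)) (hg : MemLp g 2 (volume.restrict Ω))
    (hh : MemLp h 2 (volume.restrict Ω)) {φ : ℕ → ℝ × ℝ → ℂ}
    (hφ : ∀ n, IsTestFunction Ω (φ n)) :
    Tendsto (fun n => (hφ n).triple) atTop (𝓝 (mkTriple hf hg hh)) ↔
    Tendsto (fun n => eLpNorm (f - φ n) 2 (volume.restrict Ω)) atTop (𝓝 0) ∧
    Tendsto (fun n => eLpNorm (g - partialX (φ n)) 2 (volume.restrict Ω)) atTop (𝓝 0) ∧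
    Tendsto (fun n => eLpNorm (h - partialY (φ n)) 2 (volume.restrict Ω)) atTop (𝓝 0) := by
  have hcomp : Tendsto (fun n => (hφ n).triple) atTop (𝓝 (mkTriple hf hg hh)) ↔
      ∀ i, Tendsto (fun n => (hφ n).triple i) atTop (𝓝 (mkTriple hf hg hh i)) := by
    rw [← tendsto_pi_nhds, (PiLp.homeomorph 2 _).isInducing.tendsto_nhds_iff]
    rfl
  rw [hcomp, Fin.forall_fin_succ, Fin.forall_fin_two]
  have key : ∀ (f : ℝ × ℝ → ℂ) (hf : MemLp f 2 (volume.restrict Ω)) (ψ : ℕ → ℝ × ℝ → ℂ)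
      (hψ : ∀ n, MemLp (ψ n) 2 (volume.restrict Ω)),
      Tendsto (fun n => (hψ n).toLp (ψ n)) atTop (𝓝 (hf.toLp f)) ↔
      Tendsto (fun n => eLpNorm (f - ψ n) 2 (volume.restrict Ω)) atTop (𝓝 0) := by
    intro f hf ψ hψ
    rw [Lp.tendsto_Lp_iff_tendsto_eLpNorm'' ψ hψ f hf]
    simp_rw [eLpNorm_sub_comm]
  exact and_congr (key f hf φ fun n => (hφ n).memLp _) (and_congr (key g hg (fun n => partialX (φ n))
    fun n => (hφ n).memLp_partialX _) (key h hh (fun n => partialY (φ n))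
    fun n => (hφ n).memLp_partialY _))

theorem memSobolevZero_iff {Ω : Set (ℝ × ℝ)} {u ux uy : ℝ × ℝ → ℂ} :
    MemSobolevZero Ω u ux uy ↔ ∃ (hu : MemLp u 2 (volume.restrict Ω))
      (hx : MemLp ux 2 (volume.restrict Ω)) (hy : MemLp uy 2 (volume.restrict Ω)),
      mkTriple hu hx hy ∈ sobolevTriples Ω := by
  constructor
  · rintro ⟨hu, hx, hy, φ, hφ, h⟩
    refine ⟨hu, hx, hy, ?_⟩
    have := (tendsto_mkTriple_iff hu hx hy hφ).2 h
    exact (isClosed_sobolevTriples Ω).mem_of_tendsto this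
      (Eventually.of_forall fun n => (hφ n).triple_mem)
  · rintro ⟨hu, hx, hy, h⟩
    obtain ⟨w, hw, hlim⟩ := mem_closure_iff_seq_limit.1
      (show mkTriple hu hx hy ∈ closure (testTriples Ω : Set (TripleL2 Ω)) from h)
    choose φ hφ hwφ using hw
    have e : w = fun n => (hφ n).triple := funext hwφ
    rw [e] at hlim
    exact ⟨hu, hx, hy, φ, hφ, (tendsto_mkTriple_iff hu hx hy hφ).1 hlim⟩

theorem mkTriple_coeFn {Ω : Set (ℝ × ℝ)} (w : TripleL2 Ω) :
    mkTriple (Lp.memLp (w 0)) (Lp.memLp (w 1)) (Lp.memLp (w 2)) = w := by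
  ext1 i
  fin_cases i <;> exact Lp.toLp_coeFn _ (Lp.memLp _)

theorem norm_toLp_sq {Ω : Set (ℝ × ℝ)} {f : ℝ × ℝ → ℂ}
    (hf : MemLp f 2 (volume.restrict Ω)) :
    ‖hf.toLp f‖ ^ 2 = ∫ p in Ω, ‖f p‖ ^ 2 := by
  have h1 : inner ℂ (hf.toLp f) (hf.toLp f) = ((∫ p in Ω, ‖f p‖ ^ 2 : ℝ) : ℂ) := by
    rw [L2.inner_def, ← integral_complex_ofReal]
    refine integral_congr_ae ?_
    filter_upwards [hf.coeFn_toLp] with p hp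
    rw [hp, inner_self_eq_norm_sq_to_K]
    simp
  rw [inner_self_eq_norm_sq_to_K] at h1
  rw [← Complex.ofReal_inj, ← h1]
  simp

theorem inner_toLp_conj {Ω : Set (ℝ × ℝ)} {f g : ℝ × ℝ → ℂ}
    (hf : MemLp f 2 (volume.restrict Ω)) (hg : MemLp g 2 (volume.restrict Ω)) :
    inner ℂ (hf.toLp f) (hg.toLp g) = ∫ p in Ω, g p * (starRingEnd ℂ) (f p) := by
  rw [L2.inner_def]
  refine integral_congr_ae ?_
  filter_upwards [hf.coeFn_toLp, hg.coeFn_toLp] with p hp hp'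
  rw [hp, hp']
  simp

theorem poincare_sobolev {Ω : Set (ℝ × ℝ)} {b μ : ℝ} (hb : 0 < b)
    (hΩ : ∀ p ∈ Ω, |p.2| < b) (hμ : 0 < μ) (hμb : μ * b < Real.pi / 2) :
    ∀ w ∈ sobolevTriples Ω, μ ^ 2 * ‖w 0‖ ^ 2 ≤ ‖w 2‖ ^ 2 := by
  refine sobolevTriples_induction ?_ fun φ h => ?_
  · exact isClosed_le (by fun_prop) (by fun_prop)
  · have := poincare_strip hb hΩ hμ hμb h
    rw [← norm_toLp_sq (h.memLp _), ← norm_toLp_sq (h.memLp_partialY _)] at this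
    exact this

/-! ### The weak formulation -/

/-- The operator of the form `s² ⟨v, u⟩ + κ ⟨∂ₓv, ∂ₓu⟩ + ⟨∂ᵧv, ∂ᵧu⟩`. -/
noncomputable def weakOp (Ω : Set (ℝ × ℝ)) (κ : ℝ) (s : ℂ) : TripleL2 Ω →L[ℂ] TripleL2 Ω where
  toFun w := WithLp.toLp 2 ![s ^ 2 • w 0, (κ : ℂ) • w 1, w 2]
  map_add' v w := by
    ext1 i
    fin_cases i
    · exact smul_add (s ^ 2) (v 0) (w 0)
    · exact smul_add (κ : ℂ) (v 1) (w 1)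
    · rfl
  map_smul' c w := by
    ext1 i
    fin_cases i
    · exact smul_comm (s ^ 2) c (w 0)
    · exact smul_comm (κ : ℂ) c (w 1)
    · rfl
  cont := by
    refine (PiLp.continuous_toLp 2 _).comp (continuous_pi fun i => ?_)
    fin_cases i
    · exact (PiLp.continuous_apply 2 _ 0).const_smul (s ^ 2)
    · exact (PiLp.continuous_apply 2 _ 1).const_smul (κ : ℂ)
    · exact PiLp.continuous_apply 2 _ 2

theorem inner_weakOp {Ω : Set (ℝ × ℝ)} (κ : ℝ) (s : ℂ) (v w : TripleL2 Ω) :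
    inner ℂ v (weakOp Ω κ s w) = s ^ 2 * inner ℂ (v 0) (w 0) + κ * inner ℂ (v 1) (w 1)
      + inner ℂ (v 2) (w 2) := by
  rw [PiLp.inner_apply, Fin.sum_univ_three]
  have h0 : weakOp Ω κ s w 0 = s ^ 2 • w 0 := rfl
  have h1 : weakOp Ω κ s w 1 = (κ : ℂ) • w 1 := rfl
  have h2 : weakOp Ω κ s w 2 = w 2 := rfl
  rw [h0, h1, h2, inner_smul_right, inner_smul_right]

/-- The constant function `1` as an element of `L²(Ω)`. -/
noncomputable def oneL2 (Ω : Set (ℝ × ℝ)) [IsFiniteMeasure (volume.restrict Ω)] :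
    Lp ℂ 2 (volume.restrict Ω : Measure (ℝ × ℝ)) :=
  (memLp_const (1 : ℂ)).toLp _

theorem inner_oneL2 {Ω : Set (ℝ × ℝ)} [IsFiniteMeasure (volume.restrict Ω)]
    {f : ℝ × ℝ → ℂ} (hf : MemLp f 2 (volume.restrict Ω)) :
    inner ℂ (oneL2 Ω) (hf.toLp f) = ∫ p in Ω, f p := by
  unfold oneL2
  rw [inner_toLp_conj]
  simp

theorem inner_toLp_oneL2 {Ω : Set (ℝ × ℝ)} [IsFiniteMeasure (volume.restrict Ω)]
    {f : ℝ × ℝ → ℂ} (hf : MemLp f 2 (volume.restrict Ω)) :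
    inner ℂ (hf.toLp f) (oneL2 Ω) = ∫ p in Ω, (starRingEnd ℂ) (f p) := by
  unfold oneL2
  rw [inner_toLp_conj]
  simp

/-- `w`, a function with its gradient, solves `κ ∂²u/∂x² + ∂²u/∂y² - s² u = -1`
with Dirichlet condition. -/
def IsWeakTriple (Ω : Set (ℝ × ℝ)) [IsFiniteMeasure (volume.restrict Ω)] (κ : ℝ) (s : ℂ)
    (w : TripleL2 Ω) : Prop :=
  w ∈ sobolevTriples Ω ∧
    ∀ v ∈ sobolevTriples Ω, inner ℂ v (weakOp Ω κ s w) = inner ℂ (v 0) (oneL2 Ω)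

theorem IsTestFunction.conj {Ω : Set (ℝ × ℝ)} {φ : ℝ × ℝ → ℂ} (h : IsTestFunction Ω φ) :
    IsTestFunction Ω (fun p => (starRingEnd ℂ) (φ p)) :=
  h.comp_clm (Complex.conjCLE : ℂ →L[ℝ] ℂ)

theorem partialX_conj {φ : ℝ × ℝ → ℂ} (h : Differentiable ℝ φ) (p : ℝ × ℝ) :
    partialX (fun p => (starRingEnd ℂ) (φ p)) p = (starRingEnd ℂ) (partialX φ p) :=
  partialX_comp_clm h (Complex.conjCLE : ℂ →L[ℝ] ℂ) p

theorem partialY_conj {φ : ℝ × ℝ → ℂ} (h : Differentiable ℝ φ) (p : ℝ × ℝ) :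
    partialY (fun p => (starRingEnd ℂ) (φ p)) p = (starRingEnd ℂ) (partialY φ p) :=
  partialY_comp_clm h (Complex.conjCLE : ℂ →L[ℝ] ℂ) p

theorem inner_conj_triple_weakOp {Ω : Set (ℝ × ℝ)} (κ : ℝ) (s : ℂ) {u ux uy : ℝ × ℝ → ℂ}
    (hu : MemLp u 2 (volume.restrict Ω)) (hx : MemLp ux 2 (volume.restrict Ω))
    (hy : MemLp uy 2 (volume.restrict Ω)) {φ : ℝ × ℝ → ℂ} (h : IsTestFunction Ω φ) :
    inner ℂ h.conj.triple (weakOp Ω κ s (mkTriple hu hx hy))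
      = ∫ p in Ω, ((κ : ℂ) * ux p * partialX φ p + ((1 : ℝ) : ℂ) * uy p * partialY φ p
        + s ^ 2 * u p * φ p) := by
  have hd := differentiable_of_smooth h.smooth
  rw [inner_weakOp]
  have e0 : inner ℂ (h.conj.triple 0) (mkTriple hu hx hy 0) = ∫ p in Ω, u p * φ p := by
    refine (inner_toLp_conj (h.conj.memLp _) hu).trans ?_
    simp
  have e1 : inner ℂ (h.conj.triple 1) (mkTriple hu hx hy 1) = ∫ p in Ω, ux p * partialX φ p := by
    refine (inner_toLp_conj (h.conj.memLp_partialX _) hx).trans ?_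
    simp_rw [partialX_conj hd, Complex.conj_conj]
  have e2 : inner ℂ (h.conj.triple 2) (mkTriple hu hx hy 2) = ∫ p in Ω, uy p * partialY φ p := by
    refine (inner_toLp_conj (h.conj.memLp_partialY _) hy).trans ?_
    simp_rw [partialY_conj hd, Complex.conj_conj]
  have i0 : Integrable (fun p => u p * φ p) (volume.restrict Ω) :=
    hu.integrable_mul (h.memLp _)
  have i1 : Integrable (fun p => ux p * partialX φ p) (volume.restrict Ω) :=
    hx.integrable_mul (h.memLp_partialX _)
  have i2 : Integrable (fun p => uy p * partialY φ p) (volume.restrict Ω) :=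
    hy.integrable_mul (h.memLp_partialY _)
  rw [e0, e1, e2]
  simp only [Complex.ofReal_one, one_mul, mul_assoc]
  have i12 : Integrable (fun p => (κ : ℂ) * (ux p * partialX φ p) + uy p * partialY φ p)
      (volume.restrict Ω) := (i1.const_mul _).add i2
  rw [integral_add i12 (i0.const_mul _), integral_add (i1.const_mul _) i2,
    integral_const_mul, integral_const_mul]
  ring

/-- The weak equation is bilinear while the Hilbert space form is sesquilinear. The two agree
because conjugates of test functions are test functions, and density extends the equation to all of
`H¹₀`. -/
theorem isDirichletSolution_iff {Ω : Set (ℝ × ℝ)} [IsFiniteMeasure (volume.restrict Ω)]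
    {κ : ℝ} {s : ℂ} {u : ℝ × ℝ → ℂ} :
    IsDirichletSolution Ω κ 1 s u ↔
      ∃ w, IsWeakTriple Ω κ s w ∧ w 0 =ᵐ[volume.restrict Ω] u := by
  have hone : ∀ {φ : ℝ × ℝ → ℂ} (h : IsTestFunction Ω φ),
      inner ℂ (h.conj.triple 0) (oneL2 Ω) = ∫ p in Ω, φ p := fun h =>
    (inner_toLp_oneL2 (h.conj.memLp _)).trans (by simp)
  constructor
  · rintro ⟨ux, uy, hmem, heq⟩
    obtain ⟨hu, hx, hy, hw⟩ := memSobolevZero_iff.1 hmem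
    refine ⟨mkTriple hu hx hy, ⟨hw, ?_⟩, hu.coeFn_toLp⟩
    refine sobolevTriples_induction (isClosed_eq (by fun_prop) (by fun_prop)) fun φ h => ?_
    have key := inner_conj_triple_weakOp κ s hu hx hy h.conj
    rw [heq _ h.conj, ← hone h.conj] at key
    simpa using key
  · rintro ⟨w, ⟨hw, heq⟩, hwu⟩
    have hu : MemLp u 2 (volume.restrict Ω) := (memLp_congr_ae hwu).1 (Lp.memLp (w 0))
    have hwm : mkTriple hu (Lp.memLp (w 1)) (Lp.memLp (w 2)) = w := by
      refine Eq.trans ?_ (mkTriple_coeFn w)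
      exact mkTriple_congr hwu.symm EventuallyEq.rfl EventuallyEq.rfl
    refine ⟨w 1, w 2, memSobolevZero_iff.2 ⟨hu, Lp.memLp _, Lp.memLp _,
      by rw [hwm]; exact hw⟩, ?_⟩
    intro φ h
    rw [← inner_conj_triple_weakOp κ s hu (Lp.memLp (w 1)) (Lp.memLp (w 2)) h, hwm,
      heq _ h.conj.triple_mem, hone h]

/-! ### Coercivity -/

theorem exists_shift_mem_slitPlane {b : ℝ} (hb : 0 < b) {s : ℂ} (hs : s ∉ imaginaryCuts b) :
    ∃ μ : ℝ, 0 < μ ∧ μ * b < Real.pi / 2 ∧ s ^ 2 + (μ : ℂ) ^ 2 ∈ Complex.slitPlane := by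
  have hpi := Real.pi_pos
  have hre : ∀ μ : ℝ, (s ^ 2 + (μ : ℂ) ^ 2).re = s.re ^ 2 - s.im ^ 2 + μ ^ 2 := fun μ => by
    simp [sq]
  have him : ∀ μ : ℝ, (s ^ 2 + (μ : ℂ) ^ 2).im = 2 * s.re * s.im := fun μ => by
    simp [sq]; ring
  have hcb : Real.pi / (2 * b) * b = Real.pi / 2 := by field_simp
  by_cases h : |s.im| < Real.pi / (2 * b)
  -- Any `μ` strictly between `|Im s|` and `π/(2b)` makes the real part of `s² + μ²` positive.
  · refine ⟨(|s.im| + Real.pi / (2 * b)) / 2, by positivity, ?_, Or.inl ?_⟩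
    · nlinarith
    · rw [hre, ← sq_abs s.im]
      nlinarith [abs_nonneg s.im, sq_nonneg s.re]
  · have h0 : s.re ≠ 0 := fun h0 => hs ⟨h0, not_lt.1 h⟩
    have h1 : s.im ≠ 0 := by
      intro h1
      apply h
      rw [h1, abs_zero]
      positivity
    -- Here the imaginary part `2 Re s Im s` is nonzero whatever `μ` is, so any admissible `μ`
    -- serves.
    refine ⟨Real.pi / (4 * b), by positivity, ?_, Or.inr ?_⟩
    · have : Real.pi / (4 * b) * b = Real.pi / 4 := by field_simp
      rw [this]; linarith
    · rw [him]
      exact mul_ne_zero (mul_ne_zero two_ne_zero h0) h1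

/-- Rotate back by half the argument of `r`: the direction of `r + ‖r‖` bisects the angle between
`r` and the positive axis, which is less than `π`. -/
theorem exists_rotation_of_mem_slitPlane {r : ℂ} (hr : r ∈ Complex.slitPlane) :
    ∃ ω : ℂ, ‖ω‖ ≤ 1 ∧ 0 < ω.re ∧ 0 < (ω * r).re := by
  have hr0 : r ≠ 0 := Complex.slitPlane_ne_zero hr
  have hpos : 0 < ‖r‖ := norm_pos_iff.2 hr0
  have hsum : 0 < ‖r‖ + r.re := by
    rcases hr with h | h
    · linarith
    · have := (abs_lt.1 (Complex.abs_re_lt_norm.2 h)).1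
      linarith
  set q : ℂ := r + ‖r‖ with hq
  have hqre : q.re = ‖r‖ + r.re := by simp [hq]; ring
  have hq0 : 0 < ‖q‖ := norm_pos_iff.2 fun h => by
    rw [h, Complex.zero_re] at hqre; linarith
  refine ⟨((‖q‖⁻¹ : ℝ) : ℂ) * (starRingEnd ℂ) q, ?_, ?_, ?_⟩
  · rw [norm_mul, Complex.norm_real, RCLike.norm_conj, Real.norm_of_nonneg (by positivity),
      inv_mul_cancel₀ hq0.ne']
  · rw [Complex.re_ofReal_mul, Complex.conj_re, hqre]
    positivity
  · rw [mul_assoc, Complex.re_ofReal_mul]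
    have : ((starRingEnd ℂ) q * r).re = ‖r‖ * (‖r‖ + r.re) := by
      have hn : ‖r‖ * ‖r‖ = r.re * r.re + r.im * r.im := by
        rw [← sq, Complex.sq_norm, Complex.normSq_apply]
      simp [hq, Complex.mul_re]
      linear_combination -hn
    rw [this]
    positivity

/-- Splitting `s²` as `(s² + μ²) - μ²`, the second part is absorbed by the Poincaré inequality, and
the rotation makes both remaining parts positive. Neither `c` nor `ω` depends on `κ`, as the limit
`κ → 0` requires. -/
theorem weakOp_coercive {Ω : Set (ℝ × ℝ)} {b : ℝ} (hb : 0 < b) (hΩ : ∀ p ∈ Ω, |p.2| < b)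
    {s : ℂ} (hs : s ∉ imaginaryCuts b) :
    ∃ (c : ℝ) (ω : ℂ), 0 < c ∧ ‖ω‖ ≤ 1 ∧ ∀ κ : ℝ, 0 ≤ κ → ∀ w ∈ sobolevTriples Ω,
      c * (‖w 0‖ ^ 2 + κ * ‖w 1‖ ^ 2 + ‖w 2‖ ^ 2) ≤ (ω * inner ℂ w (weakOp Ω κ s w)).re := by
  obtain ⟨μ, hμ, hμb, hslit⟩ := exists_shift_mem_slitPlane hb hs
  obtain ⟨ω, hω, hp, hq⟩ := exists_rotation_of_mem_slitPlane hslit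
  set p := ω.re with hpdef
  set q := (ω * (s ^ 2 + (μ : ℂ) ^ 2)).re with hqdef
  -- Only a fraction `δ` of the Poincaré surplus is kept, to control `‖w 2‖`; its cost `p δ μ²‖w
  -- 0‖²` uses at most half of the available `q‖w 0‖²`.
  set δ := min 1 (q / (2 * p * μ ^ 2)) with hδ
  have hδ0 : 0 < δ := lt_min one_pos (by positivity)
  have hδ1 : δ ≤ 1 := min_le_left _ _
  have hδq : p * δ * μ ^ 2 ≤ q / 2 := by
    have : δ ≤ q / (2 * p * μ ^ 2) := min_le_right _ _
    rw [le_div_iff₀ (by positivity)] at this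
    linarith
  refine ⟨min (q / 2) (p * δ), ω, lt_min (by positivity) (by positivity), hω, ?_⟩
  intro κ hκ w hw
  have hP := poincare_sobolev hb hΩ hμ hμb w hw
  have hval : (ω * inner ℂ w (weakOp Ω κ s w)).re
      = (q - p * μ ^ 2) * ‖w 0‖ ^ 2 + p * (κ * ‖w 1‖ ^ 2 + ‖w 2‖ ^ 2) := by
    rw [inner_weakOp, inner_self_eq_norm_sq_to_K, inner_self_eq_norm_sq_to_K,
      inner_self_eq_norm_sq_to_K]
    have e : ω * (s ^ 2 * ((‖w 0‖ : ℂ)) ^ 2 + (κ : ℂ) * ((‖w 1‖ : ℂ)) ^ 2 + ((‖w 2‖ : ℂ)) ^ 2)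
        = ((‖w 0‖ ^ 2 : ℝ) : ℂ) * (ω * (s ^ 2 + (μ : ℂ) ^ 2)) +
          ((κ * ‖w 1‖ ^ 2 + ‖w 2‖ ^ 2 - μ ^ 2 * ‖w 0‖ ^ 2 : ℝ) : ℂ) * ω := by
      push_cast; ring
    refine (congrArg Complex.re e).trans ?_
    rw [Complex.add_re, Complex.re_ofReal_mul, Complex.re_ofReal_mul]
    ring
  rw [hval]
  set A := ‖w 0‖ ^ 2
  set B := ‖w 1‖ ^ 2
  set D := ‖w 2‖ ^ 2
  have hA : 0 ≤ A := by positivity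
  have hB : 0 ≤ B := by positivity
  have hD : 0 ≤ D := by positivity
  have hκB : 0 ≤ κ * B := by positivity
  have h1 : p * δ * (D - μ ^ 2 * A) ≤ p * (D - μ ^ 2 * A) :=
    mul_le_mul_of_nonneg_right (mul_le_of_le_one_right hp.le hδ1) (by linarith)
  have h2 : p * δ * (κ * B) ≤ p * (κ * B) :=
    mul_le_mul_of_nonneg_right (mul_le_of_le_one_right hp.le hδ1) hκB
  calc min (q / 2) (p * δ) * (A + κ * B + D)
      = min (q / 2) (p * δ) * A + min (q / 2) (p * δ) * (κ * B) + min (q / 2) (p * δ) * D := by ring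
    _ ≤ q / 2 * A + p * δ * (κ * B) + p * δ * D := by
        gcongr
        · exact min_le_left _ _
        · exact min_le_right _ _
        · exact min_le_right _ _
    _ ≤ _ := by nlinarith

theorem norm_tripleL2_sq {Ω : Set (ℝ × ℝ)} (w : TripleL2 Ω) :
    ‖w‖ ^ 2 = ‖w 0‖ ^ 2 + ‖w 1‖ ^ 2 + ‖w 2‖ ^ 2 := by
  rw [PiLp.norm_sq_eq_of_L2, Fin.sum_univ_three]

theorem exists_isWeakTriple {Ω : Set (ℝ × ℝ)} [IsFiniteMeasure (volume.restrict Ω)] {b : ℝ}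
    (hb : 0 < b) (hΩ : ∀ p ∈ Ω, |p.2| < b) {s : ℂ} (hs : s ∉ imaginaryCuts b) {κ : ℝ}
    (hκ : 0 < κ) : ∃ w, IsWeakTriple Ω κ s w := by
  obtain ⟨c, ω, hc, hω, hco⟩ := weakOp_coercive hb hΩ hs
  obtain ⟨w, hw, h⟩ := exists_eq_of_coercive_on (sobolevTriples Ω) (isClosed_sobolevTriples Ω)
    (weakOp Ω κ s) (c := c * min κ 1) (by positivity) hω (fun v hv => by
      refine le_trans ?_ (hco κ hκ.le v hv)
      rw [norm_tripleL2_sq, mul_assoc]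
      refine mul_le_mul_of_nonneg_left ?_ hc.le
      have h1 : min κ 1 ≤ 1 := min_le_right _ _
      have h2 : min κ 1 ≤ κ := min_le_left _ _
      nlinarith [sq_nonneg ‖v 0‖, sq_nonneg ‖v 1‖, sq_nonneg ‖v 2‖])
    (WithLp.toLp 2 ![oneL2 Ω, 0, 0])
  refine ⟨w, hw, fun v hv => (h v hv).trans ?_⟩
  rw [PiLp.inner_apply, Fin.sum_univ_three]
  simp

theorem IsWeakTriple.unique {Ω : Set (ℝ × ℝ)} [IsFiniteMeasure (volume.restrict Ω)] {b : ℝ}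
    (hb : 0 < b) (hΩ : ∀ p ∈ Ω, |p.2| < b) {s : ℂ} (hs : s ∉ imaginaryCuts b) {κ : ℝ}
    (hκ : 0 ≤ κ) {w w' : TripleL2 Ω} (h : IsWeakTriple Ω κ s w) (h' : IsWeakTriple Ω κ s w') :
    w 0 = w' 0 := by
  obtain ⟨c, ω, hc, -, hco⟩ := weakOp_coercive hb hΩ hs
  have hd : w - w' ∈ sobolevTriples Ω := Submodule.sub_mem _ h.1 h'.1
  have h0 := hco κ hκ _ hd
  rw [map_sub, inner_sub_right, h.2 _ hd, h'.2 _ hd, sub_self, mul_zero, Complex.zero_re] at h0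
  have h1 : 0 ≤ κ * ‖(w - w') 1‖ ^ 2 := by positivity
  have h2 : ‖(w - w') 0‖ ^ 2 ≤ 0 := by
    by_contra! hne
    have : 0 < c * (‖(w - w') 0‖ ^ 2 + κ * ‖(w - w') 1‖ ^ 2 + ‖(w - w') 2‖ ^ 2) := by positivity
    linarith
  have h3 : ‖(w - w') 0‖ = 0 := by
    have := sq_nonneg ‖(w - w') 0‖
    exact pow_eq_zero_iff (two_ne_zero) |>.1 (le_antisymm h2 this)
  exact sub_eq_zero.1 (norm_eq_zero.1 h3)

theorem isHeatContent_iff {Ω : Set (ℝ × ℝ)} [IsFiniteMeasure (volume.restrict Ω)]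
    {κ : ℝ} {s h : ℂ} :
    IsHeatContent Ω κ 1 s h ↔
      ∃ w, IsWeakTriple Ω κ s w ∧ h = (volume.real Ω)⁻¹ * inner ℂ (oneL2 Ω) (w 0) := by
  have hint : ∀ w : TripleL2 Ω, inner ℂ (oneL2 Ω) (w 0) = ∫ p in Ω, w 0 p := fun w => by
    rw [← inner_oneL2 (Lp.memLp (w 0)), Lp.toLp_coeFn]
  have havg : ∀ (w : TripleL2 Ω) (u : ℝ × ℝ → ℂ), w 0 =ᵐ[volume.restrict Ω] u →
      ⨍ p in Ω, u p = (volume.real Ω)⁻¹ * inner ℂ (oneL2 Ω) (w 0) := fun w u hwu => by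
    rw [setAverage_eq, hint, integral_congr_ae hwu, Complex.real_smul]
  constructor
  · rintro ⟨u, hu, rfl⟩
    obtain ⟨w, hw, hwu⟩ := isDirichletSolution_iff.1 hu
    exact ⟨w, hw, havg w u hwu⟩
  · rintro ⟨w, hw, rfl⟩
    exact ⟨w 0, isDirichletSolution_iff.2 ⟨w, hw, EventuallyEq.rfl⟩,
      (havg w _ EventuallyEq.rfl).symm⟩

theorem existsUnique_isHeatContent {Ω : Set (ℝ × ℝ)} [IsFiniteMeasure (volume.restrict Ω)]
    {b : ℝ} (hb : 0 < b) (hΩ : ∀ p ∈ Ω, |p.2| < b) {s : ℂ} (hs : s ∉ imaginaryCuts b) {κ : ℝ}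
    (hκ : 0 < κ) : ∃! h : ℂ, IsHeatContent Ω κ 1 s h := by
  obtain ⟨w, hw⟩ := exists_isWeakTriple hb hΩ hs hκ
  refine ⟨_, isHeatContent_iff.2 ⟨w, hw, rfl⟩, fun h' hh' => ?_⟩
  obtain ⟨w', hw', rfl⟩ := isHeatContent_iff.1 hh'
  rw [hw'.unique hb hΩ hs hκ.le hw]

/-! ### The degenerate limit -/

/-- A Céa-type estimate: the form at `w - t` involves only `U - t 0`, `V - t 2` and `κ t 1`, and
coercivity absorbs the rest. The pair `(U, V)` need only satisfy the degenerate weak equation, with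
no `x`-derivative attached. -/
theorem norm_sub_sq_le_of_isWeakTriple {Ω : Set (ℝ × ℝ)} [IsFiniteMeasure (volume.restrict Ω)]
    {s : ℂ} {c : ℝ} {ω : ℂ} (hc : 0 < c) (hω : ‖ω‖ ≤ 1) {κ : ℝ} (hκ : 0 ≤ κ)
    (hco : ∀ w ∈ sobolevTriples Ω,
      c * (‖w 0‖ ^ 2 + κ * ‖w 1‖ ^ 2 + ‖w 2‖ ^ 2) ≤ (ω * inner ℂ w (weakOp Ω κ s w)).re)
    {U V : Lp ℂ 2 (volume.restrict Ω : Measure (ℝ × ℝ))}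
    (hUV : ∀ v ∈ sobolevTriples Ω,
      s ^ 2 * inner ℂ (v 0) U + inner ℂ (v 2) V = inner ℂ (v 0) (oneL2 Ω))
    {w t : TripleL2 Ω} (hw : IsWeakTriple Ω κ s w) (ht : t ∈ sobolevTriples Ω) :
    ‖w 0 - t 0‖ ^ 2 ≤
      ((‖s‖ ^ 2 * ‖U - t 0‖) ^ 2 + ‖V - t 2‖ ^ 2 + κ * ‖t 1‖ ^ 2) / c ^ 2 := by
  set d := w - t with hd
  have hdm : d ∈ sobolevTriples Ω := Submodule.sub_mem _ hw.1 ht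
  have hform : inner ℂ d (weakOp Ω κ s d)
      = s ^ 2 * inner ℂ (d 0) (U - t 0) + inner ℂ (d 2) (V - t 2)
        - κ * inner ℂ (d 1) (t 1) := by
    have e1 : inner ℂ d (weakOp Ω κ s d)
        = inner ℂ d (weakOp Ω κ s w) - inner ℂ d (weakOp Ω κ s t) := by
      rw [← inner_sub_right, ← map_sub]
    rw [e1, hw.2 d hdm, ← hUV d hdm, inner_weakOp, inner_sub_right, inner_sub_right]
    ring
  have hle := hco d hdm
  have hbound : (ω * inner ℂ d (weakOp Ω κ s d)).re ≤
      ‖s‖ ^ 2 * (‖d 0‖ * ‖U - t 0‖) + ‖d 2‖ * ‖V - t 2‖ + κ * (‖d 1‖ * ‖t 1‖) := by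
    calc (ω * inner ℂ d (weakOp Ω κ s d)).re ≤ ‖ω * inner ℂ d (weakOp Ω κ s d)‖ :=
          Complex.re_le_norm _
      _ ≤ ‖inner ℂ d (weakOp Ω κ s d)‖ := by
          rw [norm_mul]; exact mul_le_of_le_one_left (norm_nonneg _) hω
      _ ≤ ‖s ^ 2 * inner ℂ (d 0) (U - t 0)‖ + ‖inner ℂ (d 2) (V - t 2)‖
          + ‖(κ : ℂ) * inner ℂ (d 1) (t 1)‖ := by
          rw [hform]
          exact (norm_sub_le _ _).trans (add_le_add_left (norm_add_le _ _) _)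
      _ ≤ _ := by
          rw [norm_mul, norm_mul, norm_pow, Complex.norm_real, Real.norm_of_nonneg hκ]
          gcongr <;> exact norm_inner_le_norm _ _
  have hfin := hle.trans hbound
  have e0 : d 0 = w 0 - t 0 := rfl
  rw [← e0, le_div_iff₀ (by positivity)]
  set x := ‖d 0‖
  set y := ‖d 1‖
  set z := ‖d 2‖
  set a := ‖U - t 0‖
  set e := ‖V - t 2‖
  set m := ‖t 1‖
  -- Young's inequality for each cross term, after multiplying the coercive estimate by `2c`.
  have q1 : 0 ≤ (c * x - ‖s‖ ^ 2 * a) ^ 2 := sq_nonneg _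
  have q2 : 0 ≤ (c * z - e) ^ 2 := sq_nonneg _
  have q3 : 0 ≤ κ * (c * y - m) ^ 2 := by positivity
  have q4 : 0 ≤ κ * (c * y) ^ 2 := by positivity
  have q5 : 0 ≤ (c * z) ^ 2 := by positivity
  nlinarith

theorem tendsto_isWeakTriple {Ω : Set (ℝ × ℝ)} [IsFiniteMeasure (volume.restrict Ω)] {b : ℝ}
    (hb : 0 < b) (hΩ : ∀ p ∈ Ω, |p.2| < b) {s : ℂ} (hs : s ∉ imaginaryCuts b)
    {U V : Lp ℂ 2 (volume.restrict Ω : Measure (ℝ × ℝ))}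
    (hUV : ∀ v ∈ sobolevTriples Ω,
      s ^ 2 * inner ℂ (v 0) U + inner ℂ (v 2) V = inner ℂ (v 0) (oneL2 Ω))
    {t : ℕ → TripleL2 Ω} (ht : ∀ n, t n ∈ sobolevTriples Ω)
    (htU : Tendsto (fun n => t n 0) atTop (𝓝 U)) (htV : Tendsto (fun n => t n 2) atTop (𝓝 V))
    {ι : Type*} {l : Filter ι} {κ : ι → ℝ} (hκ : Tendsto κ l (𝓝 0)) {w : ι → TripleL2 Ω}
    (hw : ∀ᶠ i in l, 0 ≤ κ i ∧ IsWeakTriple Ω (κ i) s (w i)) :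
    Tendsto (fun i => w i 0) l (𝓝 U) := by
  obtain ⟨c, ω, hc, hω, hco⟩ := weakOp_coercive hb hΩ hs
  set F : ℕ → ℝ → ℝ := fun n k => ‖U - t n 0‖ +
    √(((‖s‖ ^ 2 * ‖U - t n 0‖) ^ 2 + ‖V - t n 2‖ ^ 2 + k * ‖t n 1‖ ^ 2) / c ^ 2) with hF
  have hbound : ∀ n, ∀ᶠ i in l, ‖w i 0 - U‖ ≤ F n (κ i) := fun n => by
    filter_upwards [hw] with i hi
    have h1 := norm_sub_sq_le_of_isWeakTriple hc hω hi.1 (hco _ hi.1) hUV hi.2 (ht n)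
    have h2 := Real.le_sqrt_of_sq_le h1
    calc ‖w i 0 - U‖ ≤ ‖w i 0 - t n 0‖ + ‖t n 0 - U‖ := norm_sub_le_norm_sub_add_norm_sub _ _ _
      _ = ‖U - t n 0‖ + ‖w i 0 - t n 0‖ := by rw [add_comm, norm_sub_rev (t n 0) U]
      _ ≤ _ := by simp only [hF]; gcongr
  have h0 : Tendsto (fun n => F n 0) atTop (𝓝 0) := by
    have a1 : Tendsto (fun n => ‖U - t n 0‖) atTop (𝓝 0) := by
      simpa using (htU.const_sub U).norm
    have a2 : Tendsto (fun n => ‖V - t n 2‖) atTop (𝓝 0) := by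
      simpa using (htV.const_sub V).norm
    have a3 := a1.add (((((a1.const_mul (‖s‖ ^ 2)).pow 2).add (a2.pow 2)).div_const (c ^ 2)).sqrt)
    simpa [hF] using a3
  rw [tendsto_iff_norm_sub_tendsto_zero, Metric.tendsto_nhds]
  intro η hη
  -- The order of limits matters: fix `n` with small error at `κ = 0`, then let `κ → 0`, so `‖t n
  -- 1‖` may grow with `n`.
  obtain ⟨n, hn⟩ := (h0.eventually (gt_mem_nhds hη)).exists
  have hcont : Tendsto (fun i => F n (κ i)) l (𝓝 (F n 0)) := by
    have : Continuous (F n) := by simp only [hF]; fun_prop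
    exact (this.tendsto 0).comp hκ
  filter_upwards [hbound n, hcont.eventually (gt_mem_nhds hn)] with i h1 h2
  rw [Real.dist_eq, sub_zero, abs_of_nonneg (norm_nonneg _)]
  exact h1.trans_lt h2

/-! ### Horizontal scaling -/

/-- The horizontal dilation `(x, y) ↦ (α x, y)`. -/
noncomputable def scaleX (α : ℝ) : ℝ × ℝ →L[ℝ] ℝ × ℝ :=
  (α • ContinuousLinearMap.fst ℝ ℝ ℝ).prod (ContinuousLinearMap.snd ℝ ℝ ℝ)

theorem scaleX_apply (α : ℝ) (p : ℝ × ℝ) : scaleX α p = (α * p.1, p.2) := rfl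

theorem scaleX_scaleX {α β : ℝ} (h : α * β = 1) (p : ℝ × ℝ) : scaleX α (scaleX β p) = p := by
  simp [scaleX_apply, ← mul_assoc, h]

/-- The horizontal dilation as a homeomorphism. -/
noncomputable def scaleXHomeo {α : ℝ} (hα : α ≠ 0) : ℝ × ℝ ≃ₜ ℝ × ℝ where
  toFun := scaleX α
  invFun := scaleX α⁻¹
  left_inv := scaleX_scaleX (inv_mul_cancel₀ hα)
  right_inv := scaleX_scaleX (mul_inv_cancel₀ hα)
  continuous_toFun := (scaleX α).continuous
  continuous_invFun := (scaleX α⁻¹).continuous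

theorem measurableEmbedding_scaleX {α : ℝ} (hα : α ≠ 0) : MeasurableEmbedding (scaleX α) :=
  (scaleXHomeo hα).measurableEmbedding

theorem map_scaleX {α : ℝ} (hα : α ≠ 0) (Ω : Set (ℝ × ℝ)) :
    Measure.map (scaleX α) (volume.restrict (scaleX α ⁻¹' Ω))
      = ENNReal.ofReal |α⁻¹| • volume.restrict Ω := by
  rw [← (measurableEmbedding_scaleX hα).restrict_map, ← Measure.restrict_smul]
  congr 1
  have h : (scaleX α : ℝ × ℝ → ℝ × ℝ) = Prod.map (fun x => α * x) id := rfl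
  rw [h, Measure.volume_eq_prod, ← Measure.map_prod_map _ _ (by fun_prop) measurable_id,
    Real.map_volume_mul_left hα, Measure.map_id, Measure.prod_smul_left]

theorem memLp_comp_scaleX {α : ℝ} (hα : α ≠ 0) {Ω : Set (ℝ × ℝ)} {f : ℝ × ℝ → ℂ}
    (hf : MemLp f 2 (volume.restrict Ω)) :
    MemLp (f ∘ scaleX α) 2 (volume.restrict (scaleX α ⁻¹' Ω)) := by
  rw [← (measurableEmbedding_scaleX hα).memLp_map_measure_iff, map_scaleX hα]
  exact hf.smul_measure ENNReal.ofReal_ne_top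

theorem tendsto_eLpNorm_comp_scaleX {α : ℝ} (hα : α ≠ 0) {Ω : Set (ℝ × ℝ)}
    {f : ℕ → ℝ × ℝ → ℂ}
    (hf : Tendsto (fun n => eLpNorm (f n) 2 (volume.restrict Ω)) atTop (𝓝 0)) :
    Tendsto (fun n => eLpNorm (f n ∘ scaleX α) 2 (volume.restrict (scaleX α ⁻¹' Ω)))
      atTop (𝓝 0) := by
  simp_rw [← (measurableEmbedding_scaleX hα).eLpNorm_map_measure, map_scaleX hα,
    eLpNorm_smul_measure_of_ne_top ENNReal.ofNat_ne_top]
  simp only [smul_eq_mul]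
  have := ENNReal.Tendsto.const_mul (a := ENNReal.ofReal |α⁻¹| ^ (1 / (2 : ENNReal)).toReal) hf
    (Or.inr (ENNReal.rpow_ne_top_of_nonneg (by positivity) ENNReal.ofReal_ne_top))
  simpa using this

theorem integral_comp_scaleX {α : ℝ} (hα : α ≠ 0) (Ω : Set (ℝ × ℝ)) (f : ℝ × ℝ → ℂ) :
    ∫ p in scaleX α ⁻¹' Ω, f (scaleX α p) = (|α⁻¹| : ℝ) * ∫ p in Ω, f p := by
  rw [← (measurableEmbedding_scaleX hα).integral_map, map_scaleX hα, integral_smul_measure,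
    ENNReal.toReal_ofReal (abs_nonneg _), Complex.real_smul]

theorem setAverage_comp_scaleX {α : ℝ} (hα : α ≠ 0) (Ω : Set (ℝ × ℝ)) (f : ℝ × ℝ → ℂ) :
    ⨍ p in scaleX α ⁻¹' Ω, f (scaleX α p) = ⨍ p in Ω, f p := by
  have hvol : volume.real (scaleX α ⁻¹' Ω) = |α⁻¹| * volume.real Ω := by
    have h := congrArg (fun ν : Measure (ℝ × ℝ) => ν.real univ) (map_scaleX hα Ω)
    simp only [measureReal_ennreal_smul_apply, measureReal_restrict_apply_univ] at h
    rw [ENNReal.toReal_ofReal (abs_nonneg _)] at h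
    rw [← h, measureReal_def, measureReal_def,
      (measurableEmbedding_scaleX hα).map_apply, preimage_univ, Measure.restrict_apply_univ]
  rw [setAverage_eq, setAverage_eq, integral_comp_scaleX hα, hvol, Complex.real_smul,
    Complex.real_smul]
  have : (|α⁻¹| : ℝ) ≠ 0 := by positivity
  have hc : ((|α⁻¹| : ℝ) : ℂ) ≠ 0 := by exact_mod_cast this
  generalize |α⁻¹| = c at hc
  push_cast
  field_simp

theorem IsTestFunction.comp_scaleX {α : ℝ} (hα : α ≠ 0) {Ω : Set (ℝ × ℝ)} {φ : ℝ × ℝ → ℂ}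
    (h : IsTestFunction Ω φ) : IsTestFunction (scaleX α ⁻¹' Ω) (φ ∘ scaleX α) where
  smooth := h.smooth.comp (scaleX α).contDiff
  compact := h.compact.comp_homeomorph (scaleXHomeo hα)
  support := (tsupport_comp_subset_preimage φ (scaleX α).continuous).trans
    (preimage_mono h.support)

theorem partialX_comp_scaleX (α : ℝ) {φ : ℝ × ℝ → ℂ} (h : Differentiable ℝ φ) (p : ℝ × ℝ) :
    partialX (φ ∘ scaleX α) p = α * partialX φ (scaleX α p) := by
  simp only [partialX]
  rw [((h _).hasFDerivAt.comp p (scaleX α).hasFDerivAt).fderiv, ContinuousLinearMap.comp_apply]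
  have : scaleX α (1, 0) = α • ((1 : ℝ), (0 : ℝ)) := by simp [scaleX_apply]
  rw [this, map_smul, Complex.real_smul]

theorem partialY_comp_scaleX (α : ℝ) {φ : ℝ × ℝ → ℂ} (h : Differentiable ℝ φ) (p : ℝ × ℝ) :
    partialY (φ ∘ scaleX α) p = partialY φ (scaleX α p) := by
  simp only [partialY]
  rw [((h _).hasFDerivAt.comp p (scaleX α).hasFDerivAt).fderiv, ContinuousLinearMap.comp_apply]
  have : scaleX α (0, 1) = ((0 : ℝ), (1 : ℝ)) := by simp [scaleX_apply]
  rw [this]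

theorem MemSobolevZero.comp_scaleX {α : ℝ} (hα : α ≠ 0) {Ω : Set (ℝ × ℝ)}
    {u ux uy : ℝ × ℝ → ℂ} (h : MemSobolevZero Ω u ux uy) :
    MemSobolevZero (scaleX α ⁻¹' Ω) (u ∘ scaleX α) ((α : ℂ) • (ux ∘ scaleX α))
      (uy ∘ scaleX α) := by
  obtain ⟨hu, hx, hy, φ, hφ, l0, l1, l2⟩ := h
  have hd := fun n => differentiable_of_smooth (hφ n).smooth
  refine ⟨memLp_comp_scaleX hα hu, (memLp_comp_scaleX hα hx).const_smul _,
    memLp_comp_scaleX hα hy, fun n => φ n ∘ scaleX α, fun n => (hφ n).comp_scaleX hα, ?_, ?_, ?_⟩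
  · have := tendsto_eLpNorm_comp_scaleX hα l0
    exact this
  · have e : ∀ n, (α : ℂ) • (ux ∘ scaleX α) - partialX (φ n ∘ scaleX α)
        = (α : ℂ) • ((ux - partialX (φ n)) ∘ scaleX α) := fun n => by
      ext p
      simp only [Pi.sub_apply, Pi.smul_apply, Function.comp_apply,
        partialX_comp_scaleX α (hd n), smul_eq_mul, mul_sub]
    simp_rw [e, eLpNorm_const_smul]
    have := ENNReal.Tendsto.const_mul (a := ‖(α : ℂ)‖ₑ) (tendsto_eLpNorm_comp_scaleX hα l1)
      (Or.inr enorm_ne_top)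
    simpa using this
  · have e : ∀ n, uy ∘ scaleX α - partialY (φ n ∘ scaleX α)
        = (uy - partialY (φ n)) ∘ scaleX α := fun n => by
      ext p
      simp only [Pi.sub_apply, Function.comp_apply, partialY_comp_scaleX α (hd n)]
    simp_rw [e]
    exact tendsto_eLpNorm_comp_scaleX hα l2

/-- Both the solution and the test function gain a factor `α` in `∂ₓ`, compensated by `κx / α²`. The
Jacobian is common to both sides of the weak equation and cancels in the average. -/
theorem IsHeatContent.comp_scaleX {α : ℝ} (hα : α ≠ 0) {Ω : Set (ℝ × ℝ)} {κx κy : ℝ} {s h : ℂ}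
    (H : IsHeatContent Ω κx κy s h) :
    IsHeatContent (scaleX α ⁻¹' Ω) (κx / α ^ 2) κy s h := by
  obtain ⟨u, ⟨ux, uy, hmem, heq⟩, rfl⟩ := H
  refine ⟨u ∘ scaleX α, ⟨_, _, hmem.comp_scaleX hα, fun φ hφ => ?_⟩,
    (setAverage_comp_scaleX hα Ω u).symm⟩
  have hψ : IsTestFunction Ω (φ ∘ scaleX α⁻¹) := by
    have := hφ.comp_scaleX (inv_ne_zero hα)
    rwa [← preimage_comp, show (scaleX α ∘ scaleX α⁻¹ : ℝ × ℝ → ℝ × ℝ) = id from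
      funext (scaleX_scaleX (mul_inv_cancel₀ hα)), preimage_id] at this
  set ψ := φ ∘ scaleX α⁻¹ with hψdef
  have hφψ : φ = ψ ∘ scaleX α := by
    ext p
    simp [hψdef, scaleX_scaleX (inv_mul_cancel₀ hα)]
  have hd := differentiable_of_smooth hψ.smooth
  have hαc : (α : ℂ) ≠ 0 := by exact_mod_cast hα
  rw [hφψ]
  have e : ∀ p, ((κx / α ^ 2 : ℝ) : ℂ) * ((α : ℂ) • (ux ∘ scaleX α)) p *
      partialX (ψ ∘ scaleX α) p + (κy : ℂ) * (uy ∘ scaleX α) p * partialY (ψ ∘ scaleX α) p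
      + s ^ 2 * (u ∘ scaleX α) p * (ψ ∘ scaleX α) p
      = (fun q => (κx : ℂ) * ux q * partialX ψ q + (κy : ℂ) * uy q * partialY ψ q
        + s ^ 2 * u q * ψ q) (scaleX α p) := fun p => by
    rw [partialX_comp_scaleX α hd, partialY_comp_scaleX α hd]
    simp only [Pi.smul_apply, Function.comp, smul_eq_mul]
    push_cast
    field_simp
  simp_rw [e]
  rw [integral_comp_scaleX hα Ω (fun q => (κx : ℂ) * ux q * partialX ψ q +
    (κy : ℂ) * uy q * partialY ψ q + s ^ 2 * u q * ψ q), heq ψ hψ]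
  exact (integral_comp_scaleX hα Ω ψ).symm

theorem isHeatContent_ellipse_iff {b : ℝ} (hb : 0 < b) {ε : ℝ} (hε : ε ∈ Ico (0 : ℝ) 1)
    {s h : ℂ} :
    IsHeatContent (ellipseDomain (b / √(1 - ε ^ 2)) b) 1 1 s h ↔
      IsHeatContent (diskDomain b) (1 - ε ^ 2) 1 s h := by
  have hpos : 0 < 1 - ε ^ 2 := by nlinarith [hε.1, hε.2]
  set r := √(1 - ε ^ 2) with hr
  have hr0 : 0 < r := Real.sqrt_pos.2 hpos
  have hr2 : r ^ 2 = 1 - ε ^ 2 := Real.sq_sqrt hpos.le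
  have hdisk : scaleX r⁻¹ ⁻¹' ellipseDomain (b / r) b = diskDomain b := by
    ext ⟨x, y⟩
    simp only [mem_preimage, scaleX_apply, ellipseDomain, diskDomain, mem_ofPred_eq]
    have : (r⁻¹ * x) ^ 2 / (b / r) ^ 2 + y ^ 2 / b ^ 2 = (x ^ 2 + y ^ 2) / b ^ 2 := by
      field_simp
    rw [this, div_lt_one (by positivity)]
  have hell : scaleX r ⁻¹' diskDomain b = ellipseDomain (b / r) b := by
    rw [← hdisk, ← preimage_comp, show (scaleX r⁻¹ ∘ scaleX r : ℝ × ℝ → ℝ × ℝ) = id from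
      funext (scaleX_scaleX (inv_mul_cancel₀ hr0.ne')), preimage_id]
  constructor
  · intro H
    have := H.comp_scaleX (inv_ne_zero hr0.ne')
    rwa [hdisk, inv_pow, div_inv_eq_mul, one_mul, hr2] at this
  · intro H
    have := H.comp_scaleX hr0.ne'
    rwa [hell, hr2, div_self hpos.ne'] at this

/-! ### The leading term as a weak solution of the degenerate problem -/

theorem abs_snd_lt_of_mem_diskDomain {b : ℝ} (hb : 0 < b) :
    ∀ p ∈ diskDomain b, |p.2| < b := by
  rintro ⟨x, y⟩ h
  simp only [diskDomain, mem_ofPred_eq] at h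
  exact abs_lt_of_sq_lt_sq (by nlinarith [sq_nonneg x]) hb.le

/-- By the ODE the integrand is the `y`-derivative of `leadingTermY · ψ`, so each chord contributes
zero: `ψ` vanishes at its ends. -/
theorem leadingTerm_weak_equation {b : ℝ} (hb : 0 < b) {s : ℂ} (hs : s ∉ imaginaryCuts b)
    {ψ : ℝ × ℝ → ℂ} (h : IsTestFunction (diskDomain b) ψ) :
    ∫ p in diskDomain b, (s ^ 2 * (leadingTerm b s p * ψ p)
      + leadingTermY b s p * partialY ψ p - ψ p) = 0 := by
  have hu := continuous_leadingTerm hb hs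
  have hv := continuous_leadingTermY hb hs
  have hψ := h.smooth.continuous
  have hψy := h.continuous_partialY
  have hzero : ∀ p ∉ diskDomain b, s ^ 2 * (leadingTerm b s p * ψ p)
      + leadingTermY b s p * partialY ψ p - ψ p = 0 := fun p hp => by
    simp [h.eq_zero hp, h.partialY_eq_zero hp]
  have hint : IntegrableOn (fun p => s ^ 2 * (leadingTerm b s p * ψ p)
      + leadingTermY b s p * partialY ψ p - ψ p) (diskDomain b) :=
    ((by fun_prop : Continuous fun p => s ^ 2 * (leadingTerm b s p * ψ p)
      + leadingTermY b s p * partialY ψ p - ψ p).continuousOn.integrableOn_compact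
      isCompact_Icc).mono_set (diskDomain_subset_Icc hb)
  rw [setIntegral_diskDomain hint]
  refine integral_eq_zero_of_ae (Eventually.of_forall fun x => ?_)
  set Y := √(b ^ 2 - x ^ 2) with hY
  have hout : ∀ t, |t| = Y → ψ (x, t) = 0 := fun t ht =>
    h.eq_zero fun hm => (mem_diskDomain_iff_abs_lt.1 hm).ne ht
  have hYn : 0 ≤ Y := Real.sqrt_nonneg _
  have hder : ∀ t ∈ uIcc (-Y) Y, HasDerivAt (fun t => leadingTermY b s (x, t) * ψ (x, t))
      (s ^ 2 * (leadingTerm b s (x, t) * ψ (x, t))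
      + leadingTermY b s (x, t) * partialY ψ (x, t) - ψ (x, t)) t := fun t _ => by
    refine ((hasDerivAt_leadingTermY b s x t).mul (h.hasDerivAt_section x t)).congr_deriv ?_
    have := leadingTerm_equation hb hs x t
    linear_combination ψ (x, t) * this
  have hc : Continuous fun t : ℝ => s ^ 2 * (leadingTerm b s (x, t) * ψ (x, t))
      + leadingTermY b s (x, t) * partialY ψ (x, t) - ψ (x, t) := by fun_prop
  simp only [Pi.zero_apply]
  rw [intervalIntegral.integral_eq_sub_of_hasDerivAt hder (hc.intervalIntegrable _ _),
    hout Y (abs_of_nonneg hYn), hout (-Y) (by rw [abs_neg, abs_of_nonneg hYn])]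
  simp

theorem memLp_diskDomain_of_continuous {b : ℝ} (hb : 0 < b) {f : ℝ × ℝ → ℂ}
    (hf : Continuous f) : MemLp f 2 (volume.restrict (diskDomain b)) := by
  have : IsFiniteMeasure (volume.restrict (Icc ((-b, -b) : ℝ × ℝ) (b, b))) :=
    ⟨by simpa using isCompact_Icc.measure_lt_top⟩
  obtain ⟨C, hC⟩ :=
    (isCompact_Icc (a := ((-b, -b) : ℝ × ℝ)) (b := (b, b))).exists_bound_of_continuousOn
      hf.continuousOn
  refine MemLp.mono_measure (Measure.restrict_mono (diskDomain_subset_Icc hb) le_rfl) ?_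
  exact MemLp.of_bound hf.aestronglyMeasurable C
    (ae_restrict_of_forall_mem measurableSet_Icc hC)

theorem leadingTerm_weak_sobolev {b : ℝ} (hb : 0 < b) {s : ℂ} (hs : s ∉ imaginaryCuts b)
    [IsFiniteMeasure (volume.restrict (diskDomain b))] :
    ∀ v ∈ sobolevTriples (diskDomain b),
      s ^ 2 * inner ℂ (v 0)
          ((memLp_diskDomain_of_continuous hb (continuous_leadingTerm hb hs)).toLp _)
        + inner ℂ (v 2)
          ((memLp_diskDomain_of_continuous hb (continuous_leadingTermY hb hs)).toLp _)
        = inner ℂ (v 0) (oneL2 (diskDomain b)) := by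
  refine sobolevTriples_induction (isClosed_eq (by fun_prop) (by fun_prop)) fun φ h => ?_
  have hU := memLp_diskDomain_of_continuous hb (continuous_leadingTerm hb hs)
  have hV := memLp_diskDomain_of_continuous hb (continuous_leadingTermY hb hs)
  have hd := differentiable_of_smooth h.smooth
  have e0 : inner ℂ (h.triple 0) (hU.toLp _)
      = ∫ p in diskDomain b, leadingTerm b s p * (starRingEnd ℂ) (φ p) :=
    inner_toLp_conj (h.memLp _) hU
  have e2 : inner ℂ (h.triple 2) (hV.toLp _)
      = ∫ p in diskDomain b, leadingTermY b s p *
        partialY (fun p => (starRingEnd ℂ) (φ p)) p := by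
    simp_rw [partialY_conj hd]
    exact inner_toLp_conj (h.memLp_partialY _) hV
  have e1 : inner ℂ (h.triple 0) (oneL2 (diskDomain b))
      = ∫ p in diskDomain b, (starRingEnd ℂ) (φ p) := inner_toLp_oneL2 (h.memLp _)
  rw [e0, e1, e2]
  have key := leadingTerm_weak_equation hb hs h.conj
  have i0 : Integrable (fun p => leadingTerm b s p * (starRingEnd ℂ) (φ p))
      (volume.restrict (diskDomain b)) := hU.integrable_mul (h.conj.memLp _)
  have i2 : Integrable (fun p => leadingTermY b s p *
      partialY (fun p => (starRingEnd ℂ) (φ p)) p)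
      (volume.restrict (diskDomain b)) := hV.integrable_mul (h.conj.memLp_partialY _)
  have i1 : Integrable (fun p => (starRingEnd ℂ) (φ p))
      (volume.restrict (diskDomain b)) := (h.conj.memLp _).integrable (by norm_num)
  have i02 : Integrable (fun p => s ^ 2 * (leadingTerm b s p * (starRingEnd ℂ) (φ p)) +
      leadingTermY b s p * partialY (fun p => (starRingEnd ℂ) (φ p)) p)
      (volume.restrict (diskDomain b)) := (i0.const_mul _).add i2
  rw [integral_sub i02 i1, integral_add (i0.const_mul _) i2, integral_const_mul] at key
  exact sub_eq_zero.1 key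

/-! ### Approximation of the leading term by test functions -/

theorem deriv_smoothTransition_of_neg {t : ℝ} (ht : t < 0) :
    deriv Real.smoothTransition t = 0 := by
  have : Real.smoothTransition =ᶠ[𝓝 t] fun _ => 0 := by
    filter_upwards [gt_mem_nhds ht] with x hx using Real.smoothTransition.zero_of_nonpos hx.le
  rw [this.deriv_eq, deriv_const]

theorem deriv_smoothTransition_of_one_lt {t : ℝ} (ht : 1 < t) :
    deriv Real.smoothTransition t = 0 := by
  have : Real.smoothTransition =ᶠ[𝓝 t] fun _ => 1 := by
    filter_upwards [lt_mem_nhds ht] with x hx using Real.smoothTransition.one_of_one_le hx.le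
  rw [this.deriv_eq, deriv_const]

theorem exists_norm_deriv_smoothTransition_le :
    ∃ M : ℝ, 0 ≤ M ∧ ∀ t, |deriv Real.smoothTransition t| ≤ M := by
  have hc : Continuous (deriv Real.smoothTransition) :=
    (Real.smoothTransition.contDiff (n := 1)).continuous_deriv le_rfl
  obtain ⟨C, hC⟩ := (isCompact_Icc (a := (0 : ℝ)) (b := 1)).exists_bound_of_continuousOn
    hc.continuousOn
  refine ⟨max C 0, le_max_right _ _, fun t => ?_⟩
  rcases lt_or_ge t 0 with h0 | h0
  · simp [deriv_smoothTransition_of_neg h0]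
  · rcases lt_or_ge 1 t with h1 | h1
    · simp [deriv_smoothTransition_of_one_lt h1]
    · exact (hC t ⟨h0, h1⟩).trans (le_max_left _ _)

/-- The argument of the cutoff at scale `1 / (n + 1)` near the boundary circle. -/
noncomputable def cutoffArg (b : ℝ) (n : ℕ) (p : ℝ × ℝ) : ℝ :=
  (n + 1) * (b ^ 2 - p.1 ^ 2 - p.2 ^ 2) - 1

/-- The leading term, cut off near the boundary circle. -/
noncomputable def leadingApprox (b : ℝ) (s : ℂ) (n : ℕ) (p : ℝ × ℝ) : ℂ :=
  (Real.smoothTransition (cutoffArg b n p) : ℂ) * leadingTerm b s p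

theorem isTestFunction_leadingApprox {b : ℝ} (hb : 0 < b) {s : ℂ} (hs : s ∉ imaginaryCuts b)
    (n : ℕ) : IsTestFunction (diskDomain b) (leadingApprox b s n) := by
  have hn : (0 : ℝ) < n + 1 := by positivity
  have hcont : Continuous (cutoffArg b n) := by unfold cutoffArg; fun_prop
  have hsub : tsupport (leadingApprox b s n) ⊆ {p | 0 ≤ cutoffArg b n p} := by
    refine closure_minimal (fun p hp => ?_) (isClosed_le continuous_const hcont)
    by_contra hneg
    refine hp ?_
    simp only [leadingApprox]
    rw [Real.smoothTransition.zero_of_nonpos (not_le.1 hneg).le]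
    simp
  have hdisk : tsupport (leadingApprox b s n) ⊆ diskDomain b := fun p hp => by
    have h1 : 0 ≤ (n + 1) * (b ^ 2 - p.1 ^ 2 - p.2 ^ 2) - 1 := hsub hp
    have h2 : 0 < b ^ 2 - p.1 ^ 2 - p.2 ^ 2 := by
      by_contra! h
      nlinarith
    simp only [diskDomain, mem_ofPred_eq]
    linarith
  refine ⟨?_, ?_, hdisk⟩
  · rw [contDiff_iff_contDiffAt]
    intro p
    by_cases hp : p ∈ tsupport (leadingApprox b s n)
    · have h1 : ContDiffAt ℝ (⊤ : ℕ∞) (leadingTerm b s) p :=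
        (contDiffOn_leadingTerm hb hs).contDiffAt ((isOpen_diskDomain b).mem_nhds (hdisk hp))
      have h2 : ContDiff ℝ (⊤ : ℕ∞) (cutoffArg b n) := by unfold cutoffArg; fun_prop
      have h3 : ContDiff ℝ (⊤ : ℕ∞) fun p => (Real.smoothTransition (cutoffArg b n p) : ℂ) :=
        Complex.ofRealCLM.contDiff.comp (Real.smoothTransition.contDiff.comp h2)
      exact h3.contDiffAt.mul h1
    · have : leadingApprox b s n =ᶠ[𝓝 p] fun _ => 0 := notMem_tsupport_iff_eventuallyEq.1 hp
      exact contDiffAt_const.congr_of_eventuallyEq this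
  · refine (isCompact_closedDisk hb).of_isClosed_subset (isClosed_tsupport _) (hdisk.trans ?_)
    intro p hp
    have hlt : p.1 ^ 2 + p.2 ^ 2 < b ^ 2 := hp
    exact hlt.le

theorem partialY_leadingApprox {b : ℝ} (hb : 0 < b) {s : ℂ} (hs : s ∉ imaginaryCuts b)
    (n : ℕ) (x y : ℝ) : partialY (leadingApprox b s n) (x, y)
      = ((deriv Real.smoothTransition (cutoffArg b n (x, y)) * (-((n + 1) * (2 * y))) : ℝ) : ℂ) *
        leadingTerm b s (x, y) +
        (Real.smoothTransition (cutoffArg b n (x, y)) : ℂ) * leadingTermY b s (x, y) := by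
  have h1 := (isTestFunction_leadingApprox hb hs n).hasDerivAt_section x y
  have h2 : HasDerivAt (fun t => cutoffArg b n (x, t)) (-((n + 1) * (2 * y))) y := by
    simp only [cutoffArg]
    refine ((((hasDerivAt_id y).pow 2).const_sub (b ^ 2 - x ^ 2)).const_mul
      ((n : ℝ) + 1)).sub_const 1 |>.congr_deriv ?_
    simp
  have h3 : HasDerivAt Real.smoothTransition
      (deriv Real.smoothTransition (cutoffArg b n (x, y))) (cutoffArg b n (x, y)) :=
    ((Real.smoothTransition.contDiff (n := 1)).differentiable (by norm_num) _).hasDerivAt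
  have h4 := ((h3.comp y h2).ofReal_comp).mul (hasDerivAt_leadingTerm b s x y)
  exact h1.unique h4

/-- Uniformity in `n` is the point: with pointwise convergence it yields `L²` convergence of the
cutoffs and their `y`-derivatives. -/
theorem leadingApprox_bounds {b : ℝ} (hb : 0 < b) {s : ℂ} (hs : s ∉ imaginaryCuts b) :
    ∃ K : ℝ, ∀ n : ℕ, ∀ p ∈ diskDomain b, ‖leadingTerm b s p‖ ≤ K ∧ ‖leadingTermY b s p‖ ≤ K ∧
      ‖leadingApprox b s n p‖ ≤ K ∧ ‖partialY (leadingApprox b s n) p‖ ≤ K := by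
  obtain ⟨C, hC0, hC⟩ := leadingTerm_bounds hb hs
  obtain ⟨M, hM0, hM⟩ := exists_norm_deriv_smoothTransition_le
  refine ⟨C * b + C + 4 * M * C, ?_⟩
  rintro n ⟨x, y⟩ hp
  obtain ⟨h1, h2⟩ := hC x y hp
  have hyY := mem_diskDomain_iff_abs_lt.1 hp
  have hYm := sqrt_sub_sq_mem_Icc hb x
  have hYsq : √(b ^ 2 - x ^ 2) ^ 2 = b ^ 2 - x ^ 2 :=
    Real.sq_sqrt (Real.sqrt_pos.1 ((abs_nonneg y).trans_lt hyY)).le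
  set Y := √(b ^ 2 - x ^ 2) with hY
  have hy0 := abs_nonneg y
  have hmc : 0 ≤ 4 * M * C := by positivity
  have hcb : 0 ≤ C * b := by positivity
  have hu : ‖leadingTerm b s (x, y)‖ ≤ C * b :=
    h2.trans (mul_le_mul_of_nonneg_left (by linarith [hYm.2]) hC0)
  have hχ : ‖(Real.smoothTransition (cutoffArg b n (x, y)) : ℂ)‖ ≤ 1 := by
    rw [Complex.norm_real, Real.norm_of_nonneg (Real.smoothTransition.nonneg _)]
    exact Real.smoothTransition.le_one _
  refine ⟨by linarith, by linarith, ?_, ?_⟩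
  · unfold leadingApprox
    rw [norm_mul]
    have := mul_le_mul hχ hu (norm_nonneg _) zero_le_one
    linarith
  · rw [partialY_leadingApprox hb hs]
    have hA : ‖(Real.smoothTransition (cutoffArg b n (x, y)) : ℂ) * leadingTermY b s (x, y)‖
        ≤ C := by
      rw [norm_mul]
      have := mul_le_mul hχ h1 (norm_nonneg _) zero_le_one
      linarith
    have hB : ‖((deriv Real.smoothTransition (cutoffArg b n (x, y)) *
        (-((n + 1) * (2 * y))) : ℝ) : ℂ) * leadingTerm b s (x, y)‖ ≤ 4 * M * C := by
      rw [norm_mul, Complex.norm_real, Real.norm_eq_abs, abs_mul, abs_neg, abs_mul, abs_mul,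
        abs_two, abs_of_pos (by positivity : (0 : ℝ) < n + 1)]
      -- The cutoff varies only where its argument is at most `1`, that is `(n + 1)(Y² - y²) ≤ 2`.
      -- There its derivative, of size `(n + 1)|y|`, meets the decay `Y - |y|`, and `(Y - |y|)|y| ≤
      -- Y² - y²`.
      rcases le_or_gt (cutoffArg b n (x, y)) 1 with hle | hgt
      · have hρ : (n + 1) * (Y ^ 2 - y ^ 2) ≤ 2 := by
          simp only [cutoffArg] at hle
          rw [hYsq]
          linarith
        have hprod : (Y - |y|) * |y| ≤ Y ^ 2 - y ^ 2 := by
          rw [← sq_abs y]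
          nlinarith
        have hn : (0 : ℝ) < n + 1 := by positivity
        calc |deriv Real.smoothTransition (cutoffArg b n (x, y))| * ((n + 1) * (2 * |y|)) *
              ‖leadingTerm b s (x, y)‖
            ≤ M * ((n + 1) * (2 * |y|)) * (C * (Y - |y|)) := by
              gcongr
              exact hM _
          _ = 2 * M * C * ((n + 1) * ((Y - |y|) * |y|)) := by ring
          _ ≤ 2 * M * C * ((n + 1) * (Y ^ 2 - y ^ 2)) := by gcongr
          _ ≤ 2 * M * C * 2 := by gcongr
          _ = _ := by ring
      · rw [deriv_smoothTransition_of_one_lt hgt]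
        simpa using hmc
    linarith [norm_add_le (((deriv Real.smoothTransition (cutoffArg b n (x, y)) *
        (-((n + 1) * (2 * y))) : ℝ) : ℂ) * leadingTerm b s (x, y))
        ((Real.smoothTransition (cutoffArg b n (x, y)) : ℂ) * leadingTermY b s (x, y))]

theorem eventually_one_lt_cutoffArg {b : ℝ} {p : ℝ × ℝ} (hp : p ∈ diskDomain b) :
    ∀ᶠ n : ℕ in atTop, 1 < cutoffArg b n p := by
  have hpos : 0 < b ^ 2 - p.1 ^ 2 - p.2 ^ 2 := by
    simp only [diskDomain, mem_ofPred_eq] at hp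
    linarith
  have h : Tendsto (fun n : ℕ => cutoffArg b n p) atTop atTop :=
    tendsto_atTop_add_const_right _ _
      ((tendsto_atTop_add_const_right _ _ tendsto_natCast_atTop_atTop).atTop_mul_const hpos)
  exact h.eventually_gt_atTop 1

theorem tendsto_toLp_of_bounded {Ω : Set (ℝ × ℝ)} (hΩ : MeasurableSet Ω)
    [IsFiniteMeasure (volume.restrict Ω)] {f : ℝ × ℝ → ℂ} {g : ℕ → ℝ × ℝ → ℂ}
    (hf : MemLp f 2 (volume.restrict Ω)) (hg : ∀ n, MemLp (g n) 2 (volume.restrict Ω)) {K : ℝ}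
    (hfK : ∀ p ∈ Ω, ‖f p‖ ≤ K) (hgK : ∀ n, ∀ p ∈ Ω, ‖g n p‖ ≤ K)
    (hlim : ∀ p ∈ Ω, Tendsto (fun n => g n p) atTop (𝓝 (f p))) :
    Tendsto (fun n => (hg n).toLp (g n)) atTop (𝓝 (hf.toLp f)) := by
  have hsq : Tendsto (fun n => ∫ p in Ω, ‖(g n - f) p‖ ^ 2) atTop (𝓝 (∫ p in Ω, (0 : ℝ))) := by
    refine tendsto_integral_of_dominated_convergence (fun _ => (K + K) ^ 2)
      (fun n => (((hg n).sub hf).1.norm.pow 2)) (integrable_const _) (fun n => ?_) ?_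
    · refine ae_restrict_of_forall_mem hΩ fun p hp => ?_
      rw [norm_pow, norm_norm]
      exact pow_le_pow_left₀ (norm_nonneg _)
        ((norm_sub_le _ _).trans (add_le_add (hgK n p hp) (hfK p hp))) 2
    · refine ae_restrict_of_forall_mem hΩ fun p hp => ?_
      have := (((hlim p hp).sub_const (f p)).norm).pow 2
      simpa using this
  rw [integral_zero] at hsq
  rw [tendsto_iff_norm_sub_tendsto_zero]
  have h2 := hsq.sqrt
  rw [Real.sqrt_zero] at h2
  refine h2.congr fun n => ?_
  rw [← norm_toLp_sq ((hg n).sub hf), Real.sqrt_sq (norm_nonneg _), MemLp.toLp_sub]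

/-! ### The limit `ε → 1⁻` and the theorem -/

theorem tendsto_heatContent_leading {b : ℝ} (hb : 0 < b) {s : ℂ} (hs : s ∉ imaginaryCuts b)
    {H : ℝ → ℂ}
    (hH : ∀ ε ∈ Ico (0 : ℝ) 1, IsHeatContent (diskDomain b) (1 - ε ^ 2) 1 s (H ε)) :
    Tendsto H (𝓝[<] 1) (𝓝 (⨍ p in diskDomain b, leadingTerm b s p)) := by
  have : IsFiniteMeasure (volume.restrict (diskDomain b)) :=
    ⟨by simpa using volume_diskDomain_lt_top hb⟩
  have hm := (isOpen_diskDomain b).measurableSet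
  have hU := memLp_diskDomain_of_continuous hb (continuous_leadingTerm hb hs)
  have hV := memLp_diskDomain_of_continuous hb (continuous_leadingTermY hb hs)
  have hφ := isTestFunction_leadingApprox hb hs
  obtain ⟨K, hK⟩ := leadingApprox_bounds hb hs
  have htU : Tendsto (fun n => (hφ n).triple 0) atTop (𝓝 (hU.toLp _)) := by
    refine tendsto_toLp_of_bounded hm hU (fun n => (hφ n).memLp _) (fun p hp => (hK 0 p hp).1)
      (fun n p hp => (hK n p hp).2.2.1) fun p hp => ?_
    refine tendsto_const_nhds.congr' ?_
    filter_upwards [eventually_one_lt_cutoffArg hp] with n hn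
    simp [leadingApprox, Real.smoothTransition.one_of_one_le hn.le]
  have htV : Tendsto (fun n => (hφ n).triple 2) atTop (𝓝 (hV.toLp _)) := by
    refine tendsto_toLp_of_bounded hm hV (fun n => (hφ n).memLp_partialY _)
      (fun p hp => (hK 0 p hp).2.1) (fun n p hp => (hK n p hp).2.2.2) ?_
    rintro ⟨x, y⟩ hp
    refine tendsto_const_nhds.congr' ?_
    filter_upwards [eventually_one_lt_cutoffArg hp] with n hn
    rw [partialY_leadingApprox hb hs, Real.smoothTransition.one_of_one_le hn.le,
      deriv_smoothTransition_of_one_lt hn]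
    simp
  -- The solution is chosen for every real `ε`, with the dummy value `0` outside `[0, 1)`, where the
  -- left-hand filter at `1` does not look.
  have hex : ∀ ε : ℝ, ∃ w : TripleL2 (diskDomain b), ε ∈ Ico (0 : ℝ) 1 →
      IsWeakTriple (diskDomain b) (1 - ε ^ 2) s w ∧
      H ε = (volume.real (diskDomain b))⁻¹ * inner ℂ (oneL2 (diskDomain b)) (w 0) := fun ε => by
    by_cases hε : ε ∈ Ico (0 : ℝ) 1
    · obtain ⟨w, hw⟩ := isHeatContent_iff.1 (hH ε hε)
      exact ⟨w, fun _ => hw⟩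
    · exact ⟨0, fun h => absurd h hε⟩
  choose w hw using hex
  have hev : ∀ᶠ ε in 𝓝[<] (1 : ℝ), ε ∈ Ico (0 : ℝ) 1 := Ico_mem_nhdsLT (by norm_num)
  have hκ : Tendsto (fun ε : ℝ => 1 - ε ^ 2) (𝓝[<] 1) (𝓝 0) := by
    have : Continuous fun ε : ℝ => 1 - ε ^ 2 := by fun_prop
    have h := this.tendsto 1
    norm_num at h
    exact h.mono_left nhdsWithin_le_nhds
  have hlim := tendsto_isWeakTriple hb (abs_snd_lt_of_mem_diskDomain hb) hs
    (leadingTerm_weak_sobolev hb hs) (fun n => (hφ n).triple_mem) htU htV hκ (w := w) (by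
      filter_upwards [hev] with ε hε
      exact ⟨by nlinarith [hε.1, hε.2], (hw ε hε).1⟩)
  have hval : ⨍ p in diskDomain b, leadingTerm b s p
      = (volume.real (diskDomain b))⁻¹ * inner ℂ (oneL2 (diskDomain b)) (hU.toLp _) := by
    rw [inner_oneL2, setAverage_eq, Complex.real_smul]
  rw [hval]
  have hcontinuous : Continuous fun f : Lp ℂ 2 (volume.restrict (diskDomain b)) =>
      (((volume.real (diskDomain b))⁻¹ : ℝ) : ℂ) * inner ℂ (oneL2 (diskDomain b)) f := by fun_prop
  refine ((hcontinuous.tendsto _).comp hlim).congr' ?_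
  filter_upwards [hev] with ε hε
  exact ((hw ε hε).2).symm

theorem mainTheorem4 (b : ℝ) (hb : 0 < b) :
    (∀ s : ℂ, s ∉ imaginaryCuts b →
      -- the heat content of the ellipse of eccentricity `ε` and its anisotropic-disk formulation
      (∀ ε ∈ Ico (0 : ℝ) 1,
        (∃! h : ℂ, IsHeatContent (diskDomain b) (1 - ε ^ 2) 1 s h) ∧
        (∀ h : ℂ, IsHeatContent (ellipseDomain (b / √(1 - ε ^ 2)) b) 1 1 s h ↔
          IsHeatContent (diskDomain b) (1 - ε ^ 2) 1 s h)) ∧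
      -- the leading term `h₀` as `ε → 1`
      ∃ h₀ : ℂ,
        (∃ u : ℝ × ℝ → ℂ, IsLeadingTerm b s u) ∧
        (∀ u : ℝ × ℝ → ℂ, IsLeadingTerm b s u → ⨍ p in diskDomain b, u p = h₀) ∧
        (∀ H : ℝ → ℂ,
          (∀ ε ∈ Ico (0 : ℝ) 1, IsHeatContent (diskDomain b) (1 - ε ^ 2) 1 s (H ε)) →
          Tendsto H (𝓝[<] 1) (𝓝 h₀)) ∧
        (s ≠ 0 → h₀ = 1 / s ^ 2 - 1 / ((Real.pi : ℂ) * (b : ℂ) * s ^ 3) *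
          ∫ φ in (0 : ℝ)..(2 * Real.pi),
            (Real.cos φ : ℂ) * Complex.tanh ((b : ℂ) * s * (Real.cos φ : ℂ))) ∧
        (‖s‖ < Real.pi / (2 * b) → HasSum (fun j : ℕ => smallTerm b s (j + 2)) h₀)) ∧
    (∀ s : ℂ, Real.pi / (2 * b) < ‖s‖ →
      ¬ ∃ S : ℂ, Tendsto (fun n : ℕ => ∑ j ∈ Finset.range n, smallTerm b s (j + 2)) atTop (𝓝 S)) := by
  have : IsFiniteMeasure (volume.restrict (diskDomain b)) :=
    ⟨by simpa using volume_diskDomain_lt_top hb⟩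
  refine ⟨fun s hs => ⟨fun ε hε => ⟨?_, fun h => isHeatContent_ellipse_iff hb hε⟩,
    ⨍ p in diskDomain b, leadingTerm b s p, ⟨_, isLeadingTerm_leadingTerm hb hs⟩, fun u hu => ?_,
    fun H hH => tendsto_heatContent_leading hb hs hH,
    average_leadingTerm_of_ne_zero hb hs, hasSum_smallTerm hb hs⟩,
    fun s hs => not_tendsto_sum_smallTerm hb hs⟩
  · exact existsUnique_isHeatContent hb (abs_snd_lt_of_mem_diskDomain hb) hs
      (by nlinarith [hε.1, hε.2])
  · rw [setAverage_eq, setAverage_eq, setIntegral_congr_fun (isOpen_diskDomain b).measurableSet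
      (hu.eqOn hb hs (isLeadingTerm_leadingTerm hb hs))]
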